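/- Let $C^*>1$ and $0<\delta\le 1/2$. There is a constant $K=K(C^*,\delta)>0$, depending only on $C^*$ and $\delta$ (in particular not on the dimension of the Hilbert space), such that the following holds. Let $H$ be a real Hilbert space, of finite or infinite dimension, and let $B(x,r)$ denote the closed ball with centre $x$ and radius $r$. Let $x_0\in H$, $r_0>0$, and let $(V_k)_{k\ge 0}$ be a sequence of nonempty finite subsets of $B(x_0,C^*r_0)$ such that - (V1) for all $k\ge 0$ and all distinct $v,v'\in V_k$, $|v-v'|\ge\delta^k r_0$; - (V2) for all $k\ge 0$ and $v\in V_k$ there is $v'\in V_{k+1}$ with $|v'-v|<C^*\delta^k r_0$; - (V3) for all $k\ge 1$ and $v\in V_k$ there is $v'\in V_{k-1}$ with $|v'-v|<C^*\delta^k r_0$. Suppose that for all $k\ge 1$ and $v\in V_k$ we are given a straight line $\ell_{k,v}$ in $H$ and a number $\alpha_{k,v}\ge 0$ such that $$\sup_{x\in (V_{k-1}\cup V_k)\cap B(v,\,66C^*\delta^{k-2}r_0)}\operatorname{dist}(x,\ell_{k,v})\le\alpha_{k,v}\,\delta^k r_0,$$ and that $$\sum_{k=1}^\infty\sum_{v\in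 V_k}\alpha_{k,v}^2\,\delta^k r_0<\infty.$$ Then the sets $V_k$ converge in the Hausdorff metric to a nonempty compact set $V\subset B(x_0,C^*r_0)$, and there is a compact connected set $\Gamma\subset B(x_0,C^*r_0)$ with $V\subset\Gamma$ and $$\mathcal H^1(\Gamma)\le K\Bigl(r_0+\sum_{k=1}^\infty\sum_{v\in V_k}\alpha_{k,v}^2\,\delta^k r_0\Bigr),$$ where $\mathcal H^1$ is the one-dimensional Hausdorff measure. -/

import Mathlib

open Filter Topology MeasureTheory
open scoped ENNReal

universe u

/-- A straight line in a real vector space: `{p + t • d : t ∈ ℝ}` with direction `d ≠ 0`. -/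
def IsStraightLine {H : Type*} [AddCommGroup H] [Module ℝ H] (l : Set H) : Prop :=
  ∃ p d : H, d ≠ 0 ∧ l = Set.range (fun t : ℝ => p + t • d)

/-! Packing counts depend on the dimension, so lengths are controlled by a potential instead. Write
ρ_k = δ^k r₀. To each v in V_k attach `locLen`, half the sum of the truncated distances to
neighbours on opposite sides of v, and let Ψ_k be the sum over V_k. Where α is small the net is
almost collinear, and by Pythagoras `locLen` agrees, up to an error of order α²ρ_k, with the length
of the cell of v in the projection to the line. Cells of V_{k+1} are disjoint and are covered by
cells of V_k, so Ψ_{k+1} ≤ Ψ_k + O(Σ α²ρ_k); points with large α pay for themselves. Where a chain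
of V_k ends, part of the cell of the last point stays uncovered, so Ψ also drops by ρ_k there
(`ScaleStep.sum_locLen_le`). Summing over scales (`card_bounds`) bounds #V_k · ρ_k, hence the
measure of the limit set W, and also the sum of ρ_k over all endpoints at all scales.

To make W connected, segments are added. At each scale the net splits into classes joined by short
steps. A class with a flat point that misses a nearby point of the net contains an endpoint
(`ScaleStep.exists_isEndpoint`), so the bridges needed are no more numerous than endpoints and
non-flat points together (`exists_spanning_pairs`), and their total length is bounded. A clopen
argument across scales (`isPreconnected_union_segments`) shows that W with the bridges is connected.
-/

/-! ### Vectors almost parallel to a line. -/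

section Perp

variable {H : Type*} [NormedAddCommGroup H] [InnerProductSpace ℝ H]

/-- The component of `d` orthogonal to the unit vector `e`. -/
def perp (e d : H) : H := d - (inner ℝ e d : ℝ) • e

lemma perp_neg_left (e d : H) : perp (-e) d = perp e d := by
  simp [perp]

lemma perp_sub (e d d' : H) : perp e (d - d') = perp e d - perp e d' := by
  simp only [perp, inner_sub_right, sub_smul]; abel

lemma inner_perp {e : H} (he : ‖e‖ = 1) (d : H) : inner ℝ e (perp e d) = 0 := by
  simp [perp, inner_sub_right, inner_smul_right, he]

lemma inner_eq_mul_add_inner_perp {e : H} (he : ‖e‖ = 1) (d d' : H) :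
    inner ℝ d d' = inner ℝ e d * inner ℝ e d' + inner ℝ (perp e d) (perp e d') := by
  have h1 : inner ℝ e e = (1 : ℝ) := by rw [real_inner_self_eq_norm_sq, he]; norm_num
  simp only [perp, inner_sub_left, inner_sub_right, inner_smul_left, inner_smul_right, h1,
    real_inner_comm e d]
  simp

lemma norm_sq_eq_inner_sq_add_norm_perp_sq {e : H} (he : ‖e‖ = 1) (d : H) :
    ‖d‖ ^ 2 = inner ℝ e d ^ 2 + ‖perp e d‖ ^ 2 := by
  rw [← real_inner_self_eq_norm_sq, ← real_inner_self_eq_norm_sq,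
    inner_eq_mul_add_inner_perp he d d]
  ring

lemma abs_inner_le_norm_of_unit {e : H} (he : ‖e‖ = 1) (d : H) : |inner ℝ e d| ≤ ‖d‖ := by
  simpa [he] using abs_real_inner_le_norm e d

lemma norm_perp_le {e : H} (he : ‖e‖ = 1) (d : H) : ‖perp e d‖ ≤ ‖d‖ := by
  have h := norm_sq_eq_inner_sq_add_norm_perp_sq he d
  nlinarith [norm_nonneg d, norm_nonneg (perp e d), sq_nonneg (inner ℝ e d : ℝ)]

lemma norm_le_abs_inner_add_norm_perp {e : H} (he : ‖e‖ = 1) (d : H) :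
    ‖d‖ ≤ |inner ℝ e d| + ‖perp e d‖ := by
  have h : d = (inner ℝ e d : ℝ) • e + perp e d := by simp [perp]
  calc ‖d‖ = ‖(inner ℝ e d : ℝ) • e + perp e d‖ := by rw [← h]
    _ ≤ _ := by
      refine (norm_add_le _ _).trans ?_
      rw [norm_smul, he, mul_one, Real.norm_eq_abs]

/-- Pythagoras factors as (‖d‖ - |⟨e,d⟩|)(‖d‖ + |⟨e,d⟩|) = ‖perp e d‖², and the second factor is at
least σ. This is one source of the squares of α in the theorem. -/
lemma norm_le_abs_inner_add_sq_div {e d : H} {σ τ : ℝ} (he : ‖e‖ = 1) (hσ : 0 < σ)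
    (hd : σ ≤ ‖d‖) (hp : ‖perp e d‖ ≤ τ) : ‖d‖ ≤ |inner ℝ e d| + τ ^ 2 / σ := by
  have h := norm_sq_eq_inner_sq_add_norm_perp_sq he d
  have hp2 : ‖perp e d‖ ^ 2 ≤ τ ^ 2 := by gcongr
  have ha := abs_nonneg (inner ℝ e d : ℝ)
  rw [← sq_abs (inner ℝ e d : ℝ)] at h
  have h1 := abs_inner_le_norm_of_unit he d
  have : (‖d‖ - |inner ℝ e d|) * σ ≤ τ ^ 2 := by
    nlinarith
  have := (le_div_iff₀ hσ).2 this
  linarith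

lemma le_abs_inner_of_norm_perp_le {e d : H} {σ : ℝ} (he : ‖e‖ = 1)
    (hd : σ ≤ ‖d‖) (hp : ‖perp e d‖ ≤ σ / 50) : 99 / 100 * ‖d‖ ≤ |inner ℝ e d| := by
  have := norm_le_abs_inner_add_norm_perp he d
  have h := norm_sq_eq_inner_sq_add_norm_perp_sq he d
  rw [← sq_abs (inner ℝ e d : ℝ)] at h
  have hp2 : ‖perp e d‖ ^ 2 ≤ (‖d‖ / 50) ^ 2 := by gcongr; linarith
  apply abs_le_of_sq_le_sq' _ (abs_nonneg _) |>.2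
  nlinarith [norm_nonneg d]

/-- Both vectors are nearly parallel to the line, so the angle between them is near 0 or near π.
This links the direction-free angle condition in `locLen` to the order of projections. -/
lemma inner_pos_iff_mul_pos {e d d' : H} {σ : ℝ} (he : ‖e‖ = 1) (hσ : 0 < σ)
    (hd : σ ≤ ‖d‖) (hp : ‖perp e d‖ ≤ σ / 50) (hd' : σ ≤ ‖d'‖) (hp' : ‖perp e d'‖ ≤ σ / 50) :
    (0 < inner ℝ e d * inner ℝ e d' → 0 < inner ℝ d d') ∧
    (inner ℝ e d * inner ℝ e d' < 0 → inner ℝ d d' < 0) ∧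
    (inner ℝ e d * inner ℝ e d' ≠ 0) := by
  have h1 := le_abs_inner_of_norm_perp_le he hd hp
  have h2 := le_abs_inner_of_norm_perp_le he hd' hp'
  have h3 : |inner ℝ (perp e d) (perp e d')| ≤ σ / 50 * (σ / 50) :=
    (abs_real_inner_le_norm _ _).trans (mul_le_mul hp hp' (norm_nonneg _) (by positivity))
  have h4 := inner_eq_mul_add_inner_perp he d d'
  have h5 : 99 / 100 * σ * (99 / 100 * σ) ≤ |inner ℝ e d * inner ℝ e d'| := by
    rw [abs_mul]
    exact mul_le_mul (by linarith) (by linarith) (by positivity) (abs_nonneg _)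
  have h6 : 0 < σ * σ := by positivity
  rw [abs_le] at h3
  refine ⟨fun h => ?_, fun h => ?_, fun h => ?_⟩
  · rw [abs_of_pos h] at h5; nlinarith
  · rw [abs_of_neg h] at h5; nlinarith
  · rw [h, abs_zero] at h5; nlinarith

/-- Two unit vectors that are both almost parallel to `f` have almost the same components
on vectors that are almost parallel to them, up to a quadratic error. -/
lemma abs_inner_sub_inner_le {e e' f d : H} {σ τ M : ℝ} (he : ‖e‖ = 1) (he' : ‖e'‖ = 1)
    (hσ : 0 < σ) (hf : σ ≤ ‖f‖) (hp : ‖perp e f‖ ≤ τ) (hp' : ‖perp e' f‖ ≤ τ)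
    (hef : 0 ≤ inner ℝ e f) (hef' : 0 ≤ inner ℝ e' f) (hd : ‖d‖ ≤ M) (hpd : ‖perp e d‖ ≤ τ) :
    |inner ℝ e d - inner ℝ e' d| ≤ 4 * M * (τ / σ) ^ 2 + 3 * τ ^ 2 / σ := by
  have hτ : 0 ≤ τ := (norm_nonneg _).trans hp
  have hf0 : 0 < ‖f‖ := hσ.trans_le hf
  set g : H := ‖f‖⁻¹ • f with hg
  have hgn : ‖g‖ = 1 := by rw [hg, norm_smul, norm_inv, norm_norm, inv_mul_cancel₀ hf0.ne']
  -- With y = ⟨b,g⟩ in [0,1], ‖b - g‖² = 2 - 2y ≤ 2(1 - y²), and 1 - y² is the squared sine of the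
  -- angle.
  have key : ∀ b : H, ‖b‖ = 1 → ‖perp b f‖ ≤ τ → 0 ≤ inner ℝ b f →
      ‖b - g‖ ^ 2 ≤ 2 * (τ / σ) ^ 2 := by
    intro b hb hpb hbf
    have h1 := norm_sq_eq_inner_sq_add_norm_perp_sq hb f
    have h2 : inner ℝ b g = inner ℝ b f / ‖f‖ := by
      rw [hg, inner_smul_right]; field_simp
    have h3 := norm_sub_sq_real b g
    rw [hb, hgn, h2] at h3
    set y := inner ℝ b f / ‖f‖ with hy
    have hy0 : 0 ≤ y := by positivity
    have hy1 : y ≤ 1 := by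
      rw [hy, div_le_one hf0]
      exact (le_abs_self _).trans (abs_inner_le_norm_of_unit hb f)
    have h4 : 1 = y ^ 2 + (‖perp b f‖ / ‖f‖) ^ 2 := by
      rw [hy, div_pow, div_pow, ← add_div, ← h1, div_self (by positivity)]
    have h5 : (‖perp b f‖ / ‖f‖) ^ 2 ≤ (τ / σ) ^ 2 := by gcongr
    nlinarith
  have k1 := key e he hp hef
  have k2 := key e' he' hp' hef'
  have hee : ‖e - e'‖ ^ 2 ≤ 8 * (τ / σ) ^ 2 := by
    have h1 : e - e' = (e - g) - (e' - g) := by abel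
    have h2 := norm_sub_le (e - g) (e' - g)
    rw [← h1] at h2
    nlinarith [sq_nonneg (‖e - g‖ - ‖e' - g‖), norm_nonneg (e - e')]
  have hee' : ‖e - e'‖ ≤ 3 * (τ / σ) := by
    apply abs_le_of_sq_le_sq' _ (by positivity) |>.2
    nlinarith [sq_nonneg (τ / σ)]
  have h1 := norm_sub_sq_real e e'
  rw [he, he'] at h1
  -- Since 1 - ⟨e,e'⟩ = ‖e - e'‖²/2, no first-order term remains: one summand carries ‖e - e'‖², the
  -- other is a product of two small factors.
  have h2 : inner ℝ e d - inner ℝ e' d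
      = inner ℝ e d * (‖e - e'‖ ^ 2 / 2) + inner ℝ (e - e') (perp e d) := by
    have h3 := inner_perp he d
    have h4 : inner ℝ e' (perp e d) = inner ℝ e' d - inner ℝ e d * inner ℝ e e' := by
      rw [perp, inner_sub_right, inner_smul_right, real_inner_comm e e']
    rw [inner_sub_left, h3, h4, h1]; ring
  rw [h2]
  refine (abs_add_le _ _).trans (add_le_add ?_ ?_)
  · rw [abs_mul, abs_of_nonneg (by positivity : (0:ℝ) ≤ ‖e - e'‖ ^ 2 / 2)]
    have := (abs_inner_le_norm_of_unit he d).trans hd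
    have hM : 0 ≤ M := (norm_nonneg _).trans hd
    calc _ ≤ M * (8 * (τ / σ) ^ 2 / 2) := by gcongr
      _ = _ := by ring
  · refine (abs_real_inner_le_norm _ _).trans ?_
    calc _ ≤ 3 * (τ / σ) * τ := by gcongr
      _ = _ := by ring

/-- A straight line has a unit direction such that the orthogonal component of a difference of
points is controlled by the distances to the line. -/
lemma IsStraightLine.exists_unit {l : Set H} (hl : IsStraightLine l) :
    ∃ e : H, ‖e‖ = 1 ∧ ∀ x y : H, ‖perp e (x - y)‖ ≤ Metric.infDist x l + Metric.infDist y l := by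
  obtain ⟨p, d, hd, rfl⟩ := hl
  have hd0 : 0 < ‖d‖ := norm_pos_iff.2 hd
  set e : H := ‖d‖⁻¹ • d with he
  have hen : ‖e‖ = 1 := by rw [he, norm_smul, norm_inv, norm_norm, inv_mul_cancel₀ hd0.ne']
  have hne : (Set.range (fun t : ℝ => p + t • d)).Nonempty := Set.range_nonempty _
  have key : ∀ x : H, ‖perp e (x - p)‖ ≤ Metric.infDist x (Set.range (fun t : ℝ => p + t • d)) := by
    intro x
    rw [Metric.le_infDist hne]
    rintro _ ⟨t, rfl⟩
    have h1 : perp e (t • d) = 0 := by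
      have : d = ‖d‖ • e := by rw [he, smul_smul, mul_inv_cancel₀ hd0.ne', one_smul]
      rw [this]
      simp [perp, inner_smul_right, hen, smul_smul]
    have h2 : perp e (x - p) = perp e (x - (p + t • d)) := by
      rw [show x - (p + t • d) = (x - p) - t • d by abel, perp_sub e (x - p), h1, sub_zero]
    rw [h2, dist_eq_norm]
    exact norm_perp_le hen _
  refine ⟨e, hen, fun x y => ?_⟩
  rw [show x - y = (x - p) - (y - p) by abel, perp_sub]
  exact (norm_sub_le _ _).trans (add_le_add (key x) (key y))

end Perp

/-! ### Overlaps of intervals on the line. -/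

section Intervals

/-- The length of the intersection of the intervals `[a, b]` and `[c, d]`. -/
noncomputable def overlap (a b c d : ℝ) : ℝ := max 0 (min b d - max a c)

lemma overlap_nonneg (a b c d : ℝ) : 0 ≤ overlap a b c d := le_max_left _ _

/-- Both versions are needed: open intervals stay disjoint when cells touch, closed ones are what a
covering provides. -/
lemma overlap_eq_volume_Ioo (a b c d : ℝ) :
    ENNReal.ofReal (overlap a b c d) = volume (Set.Ioo a b ∩ Set.Ioo c d) := by
  rw [Set.Ioo_inter_Ioo, Real.volume_Ioo, overlap]
  simp [ENNReal.ofReal_max]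

lemma overlap_eq_volume_Icc (a b c d : ℝ) :
    ENNReal.ofReal (overlap a b c d) = volume (Set.Icc a b ∩ Set.Icc c d) := by
  rw [Set.Icc_inter_Icc, Real.volume_Icc, overlap]
  simp [ENNReal.ofReal_max]

/-- Disjoint intervals overlap a given interval in total length at most its length. -/
lemma sum_overlap_le {ι : Type*} (T : Finset ι) (lo hi : ι → ℝ) {a b : ℝ} (hab : a ≤ b)
    (hdisj : ∀ i ∈ T, ∀ j ∈ T, i ≠ j → hi i ≤ lo j ∨ hi j ≤ lo i) :
    ∑ i ∈ T, overlap (lo i) (hi i) a b ≤ b - a := by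
  rw [← ENNReal.ofReal_le_ofReal_iff (sub_nonneg.2 hab),
    ENNReal.ofReal_sum_of_nonneg (fun i _ => overlap_nonneg _ _ _ _)]
  simp_rw [overlap_eq_volume_Ioo]
  rw [← measure_biUnion_finset]
  · rw [← Real.volume_Ioo]
    apply measure_mono
    simp
  · intro i hi' j hj hij
    apply Set.disjoint_left.2
    rintro x ⟨⟨h1, h2⟩, -⟩ ⟨⟨h3, h4⟩, -⟩
    rcases hdisj i hi' j hj hij with h | h <;> linarith
  · intro i _
    exact measurableSet_Ioo.inter measurableSet_Ioo

/-- If closed intervals cover an interval, the overlaps add up to at least its length. -/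
lemma sub_le_sum_overlap {ι : Type*} (T : Finset ι) (lo hi : ι → ℝ) {a b : ℝ}
    (hcov : ∀ t ∈ Set.Icc a b, ∃ i ∈ T, t ∈ Set.Icc (lo i) (hi i)) :
    b - a ≤ ∑ i ∈ T, overlap a b (lo i) (hi i) := by
  rw [← ENNReal.ofReal_le_ofReal_iff (Finset.sum_nonneg fun i _ => overlap_nonneg _ _ _ _),
    ENNReal.ofReal_sum_of_nonneg (fun i _ => overlap_nonneg _ _ _ _)]
  simp_rw [overlap_eq_volume_Icc]
  rw [← Real.volume_Icc]
  refine (measure_mono ?_).trans (measure_biUnion_finset_le T _)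
  intro t ht
  obtain ⟨i, hi', hti⟩ := hcov t ht
  exact Set.mem_biUnion hi' ⟨ht, hti⟩

/-- Separated real numbers in an interval are few. -/
lemma card_mul_le_of_separated {ι : Type*} (T : Finset ι) (x : ι → ℝ) {σ M c : ℝ} (hσ : 0 ≤ σ)
    (hM : 0 ≤ M) (hsep : ∀ i ∈ T, ∀ j ∈ T, i ≠ j → σ ≤ |x i - x j|)
    (hx : ∀ i ∈ T, |x i - c| ≤ M) : T.card * σ ≤ 2 * M + σ := by
  have h := sum_overlap_le T (fun i => x i - σ / 2) (fun i => x i + σ / 2)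
    (a := c - M - σ / 2) (b := c + M + σ / 2) (by linarith) (by
      intro i hi j hj hij
      rcases le_abs.1 (hsep i hi j hj hij) with h | h
      · right; linarith
      · left; linarith)
  have h2 : ∀ i ∈ T, σ ≤ overlap (x i - σ / 2) (x i + σ / 2) (c - M - σ / 2) (c + M + σ / 2) := by
    intro i hi
    have := abs_le.1 (hx i hi)
    have h4 : x i + σ / 2 ≤ c + M + σ / 2 := by linarith
    have h5 : c - M - σ / 2 ≤ x i - σ / 2 := by linarith
    rw [overlap, min_eq_left h4, max_eq_left h5]
    exact le_max_of_le_right (by linarith)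
  have h3 := Finset.card_nsmul_le_sum T _ _ h2
  rw [nsmul_eq_mul] at h3
  linarith

end Intervals

/-! ### Local length and projected cells. -/

section Cap

variable {H : Type*} [NormedAddCommGroup H]

open Classical in
/-- The norm truncated at `s`, where the zero vector stands for a missing neighbour. -/
noncomputable def cap (s : ℝ) (d : H) : ℝ := if d = 0 then s else min s ‖d‖

lemma cap_zero (s : ℝ) : cap s (0 : H) = s := by simp [cap]

lemma cap_le_norm {d : H} (s : ℝ) (hd : d ≠ 0) : cap s d ≤ ‖d‖ := by
  simp [cap, hd]

lemma cap_nonneg {s : ℝ} (hs : 0 ≤ s) (d : H) : 0 ≤ cap s d := by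
  unfold cap; split_ifs <;> simp [hs]

lemma cap_of_ne {d : H} (s : ℝ) (hd : d ≠ 0) : cap s d = min s ‖d‖ := by
  simp [cap, hd]

end Cap

section LocalLength

variable {H : Type*} [NormedAddCommGroup H] [InnerProductSpace ℝ H]

/-- The local length of `V` around `v` at scale `s`: half the sum of the (truncated) distances to
two points of `V` seen from `v` at an angle of at least `π / 2`, minimized. The point `v` itself
stands for a missing neighbour. -/
noncomputable def locLen (V : Finset H) (s : ℝ) (v : H) : ℝ :=
  sInf ((fun p : H × H => (cap s (p.1 - v) + cap s (p.2 - v)) / 2) ''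
    {p | p.1 ∈ V ∧ p.2 ∈ V ∧ inner ℝ (p.1 - v) (p.2 - v) ≤ (0 : ℝ)})

/-- Half the (truncated) distance from `v` to the next point of `V` in direction `e`. -/
noncomputable def halfGap (e : H) (V : Finset H) (s : ℝ) (v : H) : ℝ :=
  sInf (insert s ((fun u => (inner ℝ e (u - v) : ℝ)) ''
    {u | u ∈ V ∧ dist u v ≤ 2 * s ∧ 0 < (inner ℝ e (u - v) : ℝ)})) / 2

variable {V : Finset H} {s : ℝ} {v : H} {e e' : H}

lemma locLen_le (hs : 0 ≤ s) {u u' : H} (hu : u ∈ V) (hu' : u' ∈ V)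
    (h : inner ℝ (u - v) (u' - v) ≤ (0 : ℝ)) :
    locLen V s v ≤ (cap s (u - v) + cap s (u' - v)) / 2 := by
  apply csInf_le
  · refine ⟨0, ?_⟩
    rintro _ ⟨p, -, rfl⟩
    have h1 := cap_nonneg hs (p.1 - v)
    have h2 := cap_nonneg hs (p.2 - v)
    simp only
    linarith
  · exact ⟨(u, u'), ⟨hu, hu', h⟩, rfl⟩

lemma le_locLen (hv : v ∈ V) {m : ℝ} (h : ∀ u ∈ V, ∀ u' ∈ V,
    inner ℝ (u - v) (u' - v) ≤ (0 : ℝ) → m ≤ (cap s (u - v) + cap s (u' - v)) / 2) :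
    m ≤ locLen V s v := by
  apply le_csInf
  · exact ⟨_, (v, v), ⟨hv, hv, by simp⟩, rfl⟩
  · rintro _ ⟨p, ⟨h1, h2, h3⟩, rfl⟩
    exact h _ h1 _ h2 h3

lemma locLen_le_scale (hs : 0 ≤ s) (hv : v ∈ V) : locLen V s v ≤ s := by
  have := locLen_le (s := s) (v := v) hs hv hv (by simp)
  simpa [cap_zero] using this

lemma le_locLen_of_separated {σ : ℝ} (hv : v ∈ V) (hσ : σ ≤ s)
    (hsep : ∀ u ∈ V, u ≠ v → σ ≤ dist u v) : σ ≤ locLen V s v := by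
  have key : ∀ u ∈ V, σ ≤ cap s (u - v) := by
    intro u hu
    by_cases h : u = v
    · simpa [h, cap_zero] using hσ
    · rw [cap_of_ne _ (sub_ne_zero.2 h), ← dist_eq_norm]
      exact le_min hσ (hsep u hu h)
  refine le_locLen hv fun u hu u' hu' _ => ?_
  linarith [key u hu, key u' hu']

lemma bddBelow_halfGap (e : H) (V : Finset H) (hs : 0 ≤ s) (v : H) :
    BddBelow (insert s ((fun u => (inner ℝ e (u - v) : ℝ)) ''
    {u | u ∈ V ∧ dist u v ≤ 2 * s ∧ 0 < (inner ℝ e (u - v) : ℝ)})) := by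
  refine ⟨0, ?_⟩
  rintro _ (rfl | ⟨u, ⟨-, -, h⟩, rfl⟩)
  · exact hs
  · exact h.le

lemma halfGap_le_half (hs : 0 ≤ s) : halfGap e V s v ≤ s / 2 := by
  have := csInf_le (bddBelow_halfGap e V hs v) (Set.mem_insert _ _)
  unfold halfGap; linarith

lemma halfGap_le_inner (hs : 0 ≤ s) {u : H} (hu : u ∈ V) (hd : dist u v ≤ 2 * s)
    (h : 0 < (inner ℝ e (u - v) : ℝ)) : halfGap e V s v ≤ inner ℝ e (u - v) / 2 := by
  have := csInf_le (bddBelow_halfGap e V hs v) (Set.mem_insert_of_mem _ ⟨u, ⟨hu, hd, h⟩, rfl⟩)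
  unfold halfGap; linarith

lemma le_halfGap {m : ℝ} (h1 : m ≤ s / 2)
    (h2 : ∀ u ∈ V, dist u v ≤ 2 * s → 0 < (inner ℝ e (u - v) : ℝ) → m ≤ inner ℝ e (u - v) / 2) :
    m ≤ halfGap e V s v := by
  have : 2 * m ≤ sInf (insert s ((fun u => (inner ℝ e (u - v) : ℝ)) ''
    {u | u ∈ V ∧ dist u v ≤ 2 * s ∧ 0 < (inner ℝ e (u - v) : ℝ)})) := by
    apply le_csInf (Set.insert_nonempty _ _)
    rintro _ (rfl | ⟨u, ⟨h3, h4, h5⟩, rfl⟩)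
    · linarith
    · linarith [h2 u h3 h4 h5]
  unfold halfGap; linarith

lemma halfGap_nonneg (hs : 0 ≤ s) : 0 ≤ halfGap e V s v :=
  le_halfGap (by linarith) fun u _ _ h => by linarith

lemma halfGap_eq_or (e : H) (V : Finset H) (s : ℝ) (v : H) : halfGap e V s v = s / 2 ∨
    ∃ u ∈ V, dist u v ≤ 2 * s ∧ 0 < (inner ℝ e (u - v) : ℝ) ∧
      halfGap e V s v = inner ℝ e (u - v) / 2 := by
  have hfin : (insert s ((fun u => (inner ℝ e (u - v) : ℝ)) ''
    {u | u ∈ V ∧ dist u v ≤ 2 * s ∧ 0 < (inner ℝ e (u - v) : ℝ)})).Finite :=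
    ((V.finite_toSet.subset fun u hu => hu.1).image _).insert s
  rcases (Set.insert_nonempty _ _).csInf_mem hfin with h | ⟨u, ⟨h1, h2, h3⟩, h4⟩
  · left; unfold halfGap; rw [h]
  · right; refine ⟨u, h1, h2, h3, ?_⟩; unfold halfGap; rw [← h4]

lemma halfGap_le_halfGap_add {η : ℝ} (hs : 0 ≤ s) (hη : 0 ≤ η)
    (h : ∀ u ∈ V, dist u v ≤ 2 * s → 0 < (inner ℝ e' (u - v) : ℝ) →
      0 < (inner ℝ e (u - v) : ℝ) ∧ (inner ℝ e (u - v) : ℝ) ≤ inner ℝ e' (u - v) + η) :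
    halfGap e V s v ≤ halfGap e' V s v + η / 2 := by
  rcases halfGap_eq_or e' V s v with h1 | ⟨u, hu, hd, hpos, h1⟩
  · rw [h1]; linarith [halfGap_le_half (e := e) (V := V) (v := v) hs]
  · obtain ⟨h2, h3⟩ := h u hu hd hpos
    rw [h1]; linarith [halfGap_le_inner hs hu hd h2]

/-- On almost collinear sets, the projected cell is no longer than the local length. -/
lemma halfGap_add_halfGap_le_locLen {σ : ℝ} (he : ‖e‖ = 1) (hs : 0 ≤ s) (hσ : 0 < σ) (hv : v ∈ V)
    (hsep : ∀ u ∈ V, u ≠ v → σ ≤ dist u v)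
    (hflat : ∀ u ∈ V, dist u v ≤ s → ‖perp e (u - v)‖ ≤ σ / 50) :
    halfGap e V s v + halfGap (-e) V s v ≤ locLen V s v := by
  have hle : ∀ b : H, halfGap b V s v ≤ s / 2 := fun b => halfGap_le_half hs
  have side : ∀ u ∈ V, u ≠ v → dist u v ≤ s →
      (0 < (inner ℝ e (u - v) : ℝ) → halfGap e V s v ≤ cap s (u - v) / 2) ∧
      ((inner ℝ e (u - v) : ℝ) < 0 → halfGap (-e) V s v ≤ cap s (u - v) / 2) := by
    intro u hu huv hd
    have h1 : cap s (u - v) = ‖u - v‖ := by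
      rw [cap_of_ne _ (sub_ne_zero.2 huv), min_eq_right]; rwa [← dist_eq_norm]
    have h2 := abs_le.1 (abs_inner_le_norm_of_unit he (u - v))
    rw [h1]
    refine ⟨fun h => ?_, fun h => ?_⟩
    · linarith [halfGap_le_inner (e := e) hs hu (by linarith) h]
    · have h3 : (inner ℝ (-e) (u - v) : ℝ) = - inner ℝ e (u - v) := inner_neg_left _ _
      linarith [halfGap_le_inner (e := -e) hs hu (by linarith) (by rw [h3]; linarith)]
  have alt : ∀ u ∈ V, cap s (u - v) = s ∨ (u ≠ v ∧ dist u v ≤ s) := by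
    intro u hu
    by_cases h : u = v
    · left; simp [h, cap_zero]
    by_cases h2 : dist u v ≤ s
    · exact Or.inr ⟨h, h2⟩
    · left
      rw [cap_of_ne _ (sub_ne_zero.2 h), min_eq_left]
      rw [← dist_eq_norm]; linarith
  -- If one of the two points contributes the full cap s, the gap on its side is at most s/2 anyway,
  -- so only the other point has to be compared.
  have one : ∀ u ∈ V, halfGap e V s v + halfGap (-e) V s v ≤ (cap s (u - v) + s) / 2 := by
    intro u hu
    rcases alt u hu with h | ⟨h1, h2⟩
    · rw [h]; linarith [hle e, hle (-e)]
    · obtain ⟨h3, h4⟩ := side u hu h1 h2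
      have hne := (inner_pos_iff_mul_pos he hσ ((hsep u hu h1).trans_eq (dist_eq_norm _ _))
        (hflat u hu h2) ((hsep u hu h1).trans_eq (dist_eq_norm _ _)) (hflat u hu h2)).2.2
      rcases lt_or_gt_of_ne (left_ne_zero_of_mul hne) with h | h
      · linarith [h4 h, hle e]
      · linarith [h3 h, hle (-e)]
  refine le_locLen hv fun u hu u' hu' hin => ?_
  rcases alt u hu with h | ⟨h1, h2⟩
  · rw [h]; linarith [one u' hu']
  rcases alt u' hu' with h' | ⟨h1', h2'⟩
  · rw [h']; linarith [one u hu]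
  obtain ⟨h3, h4⟩ := side u hu h1 h2
  obtain ⟨h3', h4'⟩ := side u' hu' h1' h2'
  obtain ⟨k1, -, k3⟩ := inner_pos_iff_mul_pos he hσ ((hsep u hu h1).trans_eq (dist_eq_norm _ _))
        (hflat u hu h2) ((hsep u' hu' h1').trans_eq (dist_eq_norm _ _)) (hflat u' hu' h2')
  have k4 : inner ℝ e (u - v) * inner ℝ e (u' - v) < 0 :=
    lt_of_le_of_ne (not_lt.1 fun h => absurd (k1 h) (not_lt.2 hin)) k3
  rcases mul_neg_iff.1 k4 with ⟨h, h'⟩ | ⟨h, h'⟩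
  · linarith [h3 h, h4' h']
  · linarith [h4 h, h3' h']

/-- On almost collinear sets, the local length exceeds the projected cell only quadratically. -/
lemma locLen_le_halfGap_add_halfGap {σ τ : ℝ} (he : ‖e‖ = 1) (hs : 0 ≤ s) (hσ : 0 < σ)
    (hv : v ∈ V) (hτ : τ ≤ σ / 50) (hsep : ∀ u ∈ V, u ≠ v → σ ≤ dist u v)
    (hflat : ∀ u ∈ V, dist u v ≤ 2 * s → ‖perp e (u - v)‖ ≤ τ) :
    locLen V s v ≤ halfGap e V s v + halfGap (-e) V s v + τ ^ 2 / σ := by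
  have hpos : 0 ≤ τ ^ 2 / σ := by positivity
  -- The point attaining the half gap on a side is the competitor for `locLen`, or `v` itself when
  -- the gap is capped; the quadratic term is the excess of distance over projection.
  have nb : ∀ b : H, ‖b‖ = 1 → (∀ u ∈ V, dist u v ≤ 2 * s → ‖perp b (u - v)‖ ≤ τ) →
      ∃ u ∈ V, (u = v ∨ (u ≠ v ∧ dist u v ≤ 2 * s ∧ 0 < (inner ℝ b (u - v) : ℝ))) ∧
        cap s (u - v) ≤ 2 * halfGap b V s v + τ ^ 2 / σ := by
    intro b hb hbf
    rcases halfGap_eq_or b V s v with h | ⟨u, hu, hd, hip, h⟩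
    · exact ⟨v, hv, Or.inl rfl, by rw [h, sub_self, cap_zero]; linarith⟩
    · have huv : u ≠ v := by rintro rfl; simp at hip
      refine ⟨u, hu, Or.inr ⟨huv, hd, hip⟩, ?_⟩
      have h1 := norm_le_abs_inner_add_sq_div hb hσ
        ((hsep u hu huv).trans_eq (dist_eq_norm _ _)) (hbf u hu hd)
      rw [abs_of_pos hip] at h1
      linarith [cap_le_norm s (sub_ne_zero.2 huv)]
  obtain ⟨u, hu, hu1, hu2⟩ := nb e he hflat
  obtain ⟨u', hu', hu1', hu2'⟩ := nb (-e) (by simpa using he) (by simpa [perp_neg_left] using hflat)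
  have hin : inner ℝ (u - v) (u' - v) ≤ (0 : ℝ) := by
    rcases hu1 with rfl | ⟨h1, h2, h3⟩
    · simp
    rcases hu1' with rfl | ⟨h1', h2', h3'⟩
    · simp
    rw [inner_neg_left] at h3'
    refine ((inner_pos_iff_mul_pos he hσ ((hsep u hu h1).trans_eq (dist_eq_norm _ _))
        ((hflat u hu h2).trans hτ) ((hsep u' hu' h1').trans_eq (dist_eq_norm _ _))
        ((hflat u' hu' h2').trans hτ)).2.1 ?_).le
    exact mul_neg_of_pos_of_neg h3 (by linarith)
  linarith [locLen_le hs hu hu' hin]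

end LocalLength

/-! ### Overlaps of projected cells. -/

section Cells

variable {H : Type*} [NormedAddCommGroup H] [InnerProductSpace ℝ H]

/-- The length of the overlap of the cell of `w` in `Q` at scale `s'` and the cell of `v` in `P` at
scale `s`, both projected to direction `e`. -/
noncomputable def cellOverlap (e : H) (P : Finset H) (s : ℝ) (Q : Finset H) (s' : ℝ) (w v : H) :
    ℝ :=
  overlap (inner ℝ e w - halfGap (-e) Q s' w) (inner ℝ e w + halfGap e Q s' w)
    (inner ℝ e v - halfGap (-e) P s v) (inner ℝ e v + halfGap e P s v)

lemma overlap_neg (a b c d : ℝ) : overlap (-b) (-a) (-d) (-c) = overlap a b c d := by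
  unfold overlap
  rw [min_neg_neg, max_neg_neg]
  congr 1
  ring

/-- The direction of a line is determined only up to sign; this lets two directions be oriented
consistently. -/
lemma cellOverlap_neg (e : H) (P : Finset H) (s : ℝ) (Q : Finset H) (s' : ℝ) (w v : H) :
    cellOverlap (-e) P s Q s' w v = cellOverlap e P s Q s' w v := by
  unfold cellOverlap
  rw [← overlap_neg]
  simp only [inner_neg_left, neg_neg]
  congr 1 <;> ring

/-- Only the relative position `y - x` and the four half gaps matter, so the absolute projections,
which may change much with the direction, drop out. -/
lemma overlap_le_overlap_add {x l r y l' r' X L R Y L' R' η : ℝ} (hη : 0 ≤ η)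
    (h : |(y - x) - (Y - X)| ≤ η) (hl : l ≤ L + η / 2) (hr : r ≤ R + η / 2)
    (hl' : l' ≤ L' + η / 2) (hr' : r' ≤ R' + η / 2) :
    overlap (x - l) (x + r) (y - l') (y + r') ≤
      overlap (X - L) (X + R) (Y - L') (Y + R') + 2 * η := by
  have h1 := abs_le.1 h
  have h2 := overlap_nonneg (X - L) (X + R) (Y - L') (Y + R')
  have h3 : min (X + R) (Y + R') - max (X - L) (Y - L') ≤
    overlap (X - L) (X + R) (Y - L') (Y + R') := le_max_right _ _
  have h4 := min_le_left (x + r) (y + r')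
  have h5 := min_le_right (x + r) (y + r')
  have h6 := le_max_left (x - l) (y - l')
  have h7 := le_max_right (x - l) (y - l')
  rw [overlap]
  apply max_le (by linarith)
  rcases min_choice (X + R) (Y + R') with h8 | h8 <;>
  rcases max_choice (X - L) (Y - L') with h9 | h9 <;>
  rw [h8, h9] at h3 <;> linarith

end Cells

/-! ### Two consecutive scales seen in one direction. -/

section ScaleStep

variable {H : Type*} [NormedAddCommGroup H] [InnerProductSpace ℝ H]

/-- Two consecutive scales: `P` is `ρ`-separated, `Q` is `ρ'`-separated and close to `P`, and
around each `w ∈ Q` the set `P ∪ Q` is close to a line in direction `e w`, with error `a w`. -/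
structure ScaleStep (C ρ ρ' : ℝ) (P Q : Finset H) (a : H → ℝ) (e : H → H) : Prop where
  one_lt : 1 < C
  pos : 0 < ρ'
  two_mul_le : 2 * ρ' ≤ ρ
  sepP : ∀ u ∈ P, ∀ v ∈ P, u ≠ v → ρ ≤ dist u v
  sepQ : ∀ u ∈ Q, ∀ v ∈ Q, u ≠ v → ρ' ≤ dist u v
  parent : ∀ w ∈ Q, ∃ v ∈ P, dist w v ≤ C * ρ'
  unit : ∀ w ∈ Q, ‖e w‖ = 1
  nonneg : ∀ w ∈ Q, 0 ≤ a w
  flat : ∀ w ∈ Q, ∀ x, x ∈ P ∨ x ∈ Q → ∀ y, y ∈ P ∨ y ∈ Q → dist x w ≤ 132 * C * ρ →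
    dist y w ≤ 132 * C * ρ → ‖perp (e w) (x - y)‖ ≤ 2 * a w * ρ'

/-- All points of `V` within distance `s` of `v` lie on one side of `v`. -/
def IsEndpoint (V : Finset H) (s : ℝ) (v : H) : Prop :=
  ∀ z ∈ V, ∀ z' ∈ V, z ≠ v → z' ≠ v → dist z v ≤ s → dist z' v ≤ s →
    0 < (inner ℝ (z - v) (z' - v) : ℝ)

/-- `P ∪ Q` is `ρ' / 50`-close to direction `e` near `v`. -/
def FlatNear (C ρ ρ' : ℝ) (P Q : Finset H) (e v : H) : Prop :=
  ∀ x, x ∈ P ∨ x ∈ Q → ∀ y, y ∈ P ∨ y ∈ Q → dist x v ≤ 100 * C * ρ →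
    dist y v ≤ 100 * C * ρ → ‖perp e (x - y)‖ ≤ ρ' / 50

namespace ScaleStep

variable {C ρ ρ' : ℝ} {P Q : Finset H} {a : H → ℝ} {e : H → H}

lemma pos' (h : ScaleStep C ρ ρ' P Q a e) : 0 < ρ := by linarith [h.pos, h.two_mul_le]

lemma mul_pos (h : ScaleStep C ρ ρ' P Q a e) : 0 < C * ρ :=
  _root_.mul_pos (by linarith [h.one_lt]) h.pos'

lemma mul_pos' (h : ScaleStep C ρ ρ' P Q a e) : 0 < C * ρ' :=
  _root_.mul_pos (by linarith [h.one_lt]) h.pos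

lemma two_mul_mul_le (h : ScaleStep C ρ ρ' P Q a e) : 2 * (C * ρ') ≤ C * ρ := by
  nlinarith [h.one_lt, h.two_mul_le]

lemma le_mul (h : ScaleStep C ρ ρ' P Q a e) : ρ ≤ C * ρ := by
  nlinarith [h.one_lt, h.pos']

/-- The window 132 in `flat` leaves room for radius 100 around any `v` within 30 of `w`; the factor
2 there turns 1/100 into 1/50. -/
lemma flatNear (h : ScaleStep C ρ ρ' P Q a e) {w v : H} (hw : w ∈ Q) (hwv : dist w v ≤ 30 * C * ρ)
    (ha : a w ≤ 1 / 100) : FlatNear C ρ ρ' P Q (e w) v := by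
  intro x hx y hy hxv hyv
  have h1 := dist_triangle x v w
  have h2 := dist_triangle y v w
  rw [dist_comm v w] at h1 h2
  have := h.mul_pos
  refine (h.flat w hw x hx y hy (by linarith) (by linarith)).trans ?_
  nlinarith [h.pos]

lemma _root_.FlatNear.neg {b v : H} (h : FlatNear C ρ ρ' P Q b v) :
    FlatNear C ρ ρ' P Q (-b) v := by
  intro x hx y hy hxv hyv
  rw [perp_neg_left]
  exact h x hx y hy hxv hyv

/-- Cells of distinct points of `Q` near `v` are disjoint. -/
lemma cells_disjoint (h : ScaleStep C ρ ρ' P Q a e) {b v w w' : H} (hb : ‖b‖ = 1)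
    (hf : FlatNear C ρ ρ' P Q b v) (hw : w ∈ Q) (hw' : w' ∈ Q) (hwv : dist w v ≤ 30 * C * ρ)
    (hwv' : dist w' v ≤ 30 * C * ρ) (hlt : inner ℝ b w < (inner ℝ b w' : ℝ)) :
    inner ℝ b w + halfGap b Q (10 * C * ρ') w ≤
      inner ℝ b w' - halfGap (-b) Q (10 * C * ρ') w' := by
  have hC := h.mul_pos
  have hC' := h.mul_pos'
  have hs : 0 ≤ 10 * C * ρ' := by linarith
  have hne : w' ≠ w := by rintro rfl; exact lt_irrefl _ hlt
  have h1 : (inner ℝ b (w' - w) : ℝ) = inner ℝ b w' - inner ℝ b w := inner_sub_right _ _ _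
  have h2 : (inner ℝ (-b) (w - w') : ℝ) = inner ℝ b w' - inner ℝ b w := by
    rw [inner_neg_left, inner_sub_right]; ring
  by_cases hd : dist w' w ≤ 2 * (10 * C * ρ')
  · have h3 := halfGap_le_inner (e := b) hs hw' hd (by rw [h1]; linarith)
    have h4 := halfGap_le_inner (e := -b) (v := w') hs hw (by rwa [dist_comm])
      (by rw [h2]; linarith)
    rw [h1] at h3; rw [h2] at h4
    linarith
  -- Points more than 2s apart project to points more than s apart, while each half gap is at most
  -- s/2; hence the window 2s in `halfGap` loses nothing.
  · have h3 := halfGap_le_half (e := b) (V := Q) (v := w) hs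
    have h4 := halfGap_le_half (e := -b) (V := Q) (v := w') hs
    have h5 := le_abs_inner_of_norm_perp_le hb (σ := ρ')
      ((h.sepQ w' hw' w hw hne).trans_eq (dist_eq_norm _ _))
      (hf w' (Or.inr hw') w (Or.inr hw) (by linarith) (by linarith))
    rw [h1, abs_of_pos (by linarith), ← dist_eq_norm] at h5
    linarith

/-- The cells of points of `Q` near `v` overlap the cell of `v` in total length at most
the local length of `v`. -/
lemma sum_cellOverlap_le (h : ScaleStep C ρ ρ' P Q a e) {b v : H} (hb : ‖b‖ = 1)
    (hf : FlatNear C ρ ρ' P Q b v) (hv : v ∈ P) {T : Finset H} (hT : T ⊆ Q)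
    (hTv : ∀ w ∈ T, dist w v ≤ 30 * C * ρ) :
    (∑ w ∈ T, cellOverlap b P (10 * C * ρ) Q (10 * C * ρ') w v ≤
      halfGap b P (10 * C * ρ) v + halfGap (-b) P (10 * C * ρ) v) ∧
    ((∀ z ∈ P, dist z v ≤ 10 * C * ρ → (inner ℝ b (z - v) : ℝ) ≤ 0) →
      ∑ w ∈ T, cellOverlap b P (10 * C * ρ) Q (10 * C * ρ') w v + ρ ≤
      halfGap b P (10 * C * ρ) v + halfGap (-b) P (10 * C * ρ) v) := by
  have hC := h.mul_pos
  have hC' := h.mul_pos'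
  have hCC := h.two_mul_mul_le
  have hs : 0 ≤ 10 * C * ρ := by linarith
  have hs' : 0 ≤ 10 * C * ρ' := by linarith
  set lo : H → ℝ := fun w => inner ℝ b w - halfGap (-b) Q (10 * C * ρ') w with hlo
  set hi : H → ℝ := fun w => inner ℝ b w + halfGap b Q (10 * C * ρ') w with hhi
  have n1 := halfGap_nonneg (e := b) (V := P) (v := v) hs
  have n2 := halfGap_nonneg (e := -b) (V := P) (v := v) hs
  have hdisj : ∀ w ∈ T, ∀ w' ∈ T, w ≠ w' → hi w ≤ lo w' ∨ hi w' ≤ lo w := by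
    intro w hw w' hw' hne
    have h5 := le_abs_inner_of_norm_perp_le hb (σ := ρ')
      ((h.sepQ w (hT hw) w' (hT hw') hne).trans_eq (dist_eq_norm _ _))
      (hf w (Or.inr (hT hw)) w' (Or.inr (hT hw')) (by linarith [hTv w hw])
        (by linarith [hTv w' hw']))
    have h6 := h.sepQ w (hT hw) w' (hT hw') hne
    have h7 := h.pos
    rw [← dist_eq_norm, inner_sub_right] at h5
    rcases le_abs.1 h5 with h8 | h8
    · right
      exact h.cells_disjoint hb hf (hT hw') (hT hw) (hTv w' hw') (hTv w hw) (by linarith)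
    · left
      exact h.cells_disjoint hb hf (hT hw) (hT hw') (hTv w hw) (hTv w' hw') (by linarith)
  refine ⟨?_, fun hend => ?_⟩
  · have := sum_overlap_le T lo hi (a := inner ℝ b v - halfGap (-b) P (10 * C * ρ) v)
      (b := inner ℝ b v + halfGap b P (10 * C * ρ) v) (by linarith) hdisj
    unfold cellOverlap
    linarith
  -- With no point of `P` ahead within 10Cρ, the next one projects beyond 9Cρ, so the cell of `v`
  -- extends by at least 9/2·Cρ. By its parent, each cell of `Q` either stops before 3Cρ or starts
  -- beyond the cell of `v`. The uncovered stretch has length at least 3/2·Cρ ≥ ρ.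
  · have far : ∀ u ∈ P, dist u v ≤ 90 * C * ρ → 0 < (inner ℝ b (u - v) : ℝ) →
        9 * (C * ρ) ≤ inner ℝ b (u - v) := by
      intro u hu hd hpos
      have huv : u ≠ v := by rintro rfl; simp at hpos
      have hd' : 10 * C * ρ < dist u v := by
        by_contra hcon
        exact absurd (hend u hu (not_lt.1 hcon)) (not_le.2 hpos)
      have h5 := le_abs_inner_of_norm_perp_le hb (σ := ρ')
        ((by linarith [h.sepP u hu v hv huv, h.two_mul_le, h.pos] : ρ' ≤ dist u v).trans_eq
          (dist_eq_norm _ _))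
        (hf u (Or.inl hu) v (Or.inl hv) (by linarith) (by rw [dist_self]; linarith))
      rw [abs_of_pos hpos, ← dist_eq_norm] at h5
      linarith
    have hR : 9 / 2 * (C * ρ) ≤ halfGap b P (10 * C * ρ) v := by
      refine le_halfGap (by linarith) fun u hu hd hpos => ?_
      linarith [far u hu (by linarith) hpos]
    have hcell : ∀ w ∈ T, hi w ≤ inner ℝ b v + 3 * (C * ρ) ∨
        inner ℝ b v + halfGap b P (10 * C * ρ) v ≤ lo w := by
      intro w hw
      obtain ⟨u, hu, hwu⟩ := h.parent w (hT hw)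
      have h1 := abs_le.1 ((abs_inner_le_norm_of_unit hb (w - u)).trans
        ((dist_eq_norm w u).symm.le.trans hwu))
      rw [inner_sub_right] at h1
      have h2 := halfGap_le_half (e := b) (V := Q) (v := w) hs'
      have h3 := halfGap_le_half (e := -b) (V := Q) (v := w) hs'
      have h4 := halfGap_le_half (e := b) (V := P) (v := v) hs
      have hdu : dist u v ≤ 90 * C * ρ := by
        have := dist_triangle u w v
        rw [dist_comm u w] at this
        linarith [hTv w hw]
      rcases le_or_gt (inner ℝ b (u - v) : ℝ) 0 with h5 | h5
      · left
        rw [inner_sub_right] at h5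
        simp only [hhi]; linarith
      · right
        have h6 := far u hu hdu h5
        rw [inner_sub_right] at h6
        simp only [hlo]; linarith
    have := sum_overlap_le T lo hi (a := inner ℝ b v - halfGap (-b) P (10 * C * ρ) v)
      (b := inner ℝ b v + 3 * (C * ρ)) (by linarith) hdisj
    have hle : ∀ w ∈ T, cellOverlap b P (10 * C * ρ) Q (10 * C * ρ') w v ≤
        overlap (lo w) (hi w) (inner ℝ b v - halfGap (-b) P (10 * C * ρ) v)
          (inner ℝ b v + 3 * (C * ρ)) := by
      intro w hw
      rcases hcell w hw with h5 | h5
      · unfold cellOverlap overlap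
        apply max_le_max le_rfl
        apply sub_le_sub_right
        exact le_min (min_le_left _ _) ((min_le_left _ _).trans h5)
      · unfold cellOverlap
        nth_rewrite 1 [overlap]
        apply max_le (overlap_nonneg _ _ _ _)
        refine le_trans ?_ (overlap_nonneg _ _ _ _)
        refine sub_nonpos.2 ((min_le_right _ _).trans (h5.trans (le_max_left _ _)))
    linarith [Finset.sum_le_sum hle, h.le_mul]

/-- The cells of the points of `P` near `w` cover the cell of `w`. -/
lemma le_sum_cellOverlap (h : ScaleStep C ρ ρ' P Q a e) {b w : H} (hb : ‖b‖ = 1)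
    (hf : FlatNear C ρ ρ' P Q b w) (hw : w ∈ Q) :
    halfGap b Q (10 * C * ρ') w + halfGap (-b) Q (10 * C * ρ') w ≤
      ∑ v ∈ P with dist w v ≤ 30 * C * ρ,
        cellOverlap b P (10 * C * ρ) Q (10 * C * ρ') w v := by
  have hC := h.mul_pos
  have hC' := h.mul_pos'
  have hCC := h.two_mul_mul_le
  have hs : 0 ≤ 10 * C * ρ := by linarith
  have hs' : 0 ≤ 10 * C * ρ' := by linarith
  have h2 := halfGap_le_half (e := b) (V := Q) (v := w) hs'
  have h3 := halfGap_le_half (e := -b) (V := Q) (v := w) hs'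
  have := sub_le_sum_overlap (P.filter fun v => dist w v ≤ 30 * C * ρ)
    (fun v => inner ℝ b v - halfGap (-b) P (10 * C * ρ) v)
    (fun v => inner ℝ b v + halfGap b P (10 * C * ρ) v)
    (a := inner ℝ b w - halfGap (-b) Q (10 * C * ρ') w)
    (b := inner ℝ b w + halfGap b Q (10 * C * ρ') w) ?_
  · unfold cellOverlap; linarith
  rintro t ⟨ht1, ht2⟩
  obtain ⟨v₀, hv₀, hwv₀⟩ := h.parent w hw
  -- The cell containing t is that of the point with nearest projection. Minimizing only within 30Cρ
  -- is harmless: `v` turns out to lie within 6Cρ of `w`, so the window of radius 20Cρ defining its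
  -- half gaps stays inside.
  obtain ⟨v, hv, hmin⟩ := (P.filter fun v => dist w v ≤ 30 * C * ρ).exists_min_image
    (fun v => |inner ℝ b v - t|) ⟨v₀, Finset.mem_filter.2 ⟨hv₀, by linarith⟩⟩
  obtain ⟨hvP, hvw⟩ := Finset.mem_filter.1 hv
  refine ⟨v, hv, ?_⟩
  have h4 := abs_le.1 ((abs_inner_le_norm_of_unit hb (w - v₀)).trans
    ((dist_eq_norm w v₀).symm.le.trans hwv₀))
  rw [inner_sub_right] at h4
  have h5 : |inner ℝ b v - t| ≤ 3 * (C * ρ) := by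
    refine (hmin v₀ (Finset.mem_filter.2 ⟨hv₀, by linarith⟩)).trans ?_
    rw [abs_le]; constructor <;> linarith
  have h5' := abs_le.1 h5
  have h6 : dist w v ≤ 6 * (C * ρ) := by
    have h7 := norm_le_abs_inner_add_norm_perp hb (w - v)
    have h8 := hf w (Or.inr hw) v (Or.inl hvP) (by rw [dist_self]; linarith)
      (by rw [dist_comm]; linarith)
    have h9 : |(inner ℝ b (w - v) : ℝ)| ≤ 11 / 2 * (C * ρ) := by
      rw [inner_sub_right, abs_le]; constructor <;> linarith
    rw [dist_eq_norm]
    linarith [h.le_mul, h.two_mul_le, h.pos]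
  have near : ∀ u ∈ P, dist u v ≤ 2 * (10 * C * ρ) → |inner ℝ b v - t| ≤ |inner ℝ b u - t| := by
    intro u hu hd
    refine hmin u (Finset.mem_filter.2 ⟨hu, ?_⟩)
    have := dist_triangle w v u
    rw [dist_comm v u] at this
    linarith
  have h7 := le_abs_self (inner ℝ b v - t)
  have h8 := neg_le_abs (inner ℝ b v - t)
  constructor
  · have : inner ℝ b v - t ≤ halfGap (-b) P (10 * C * ρ) v := by
      refine le_halfGap (by linarith) fun u hu hd hpos => ?_
      rw [inner_neg_left, inner_sub_right] at hpos ⊢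
      have h9 := near u hu hd
      rcases le_abs.1 (h7.trans h9) with h10 | h10 <;> linarith
    linarith
  · have : t - inner ℝ b v ≤ halfGap b P (10 * C * ρ) v := by
      refine le_halfGap (by linarith) fun u hu hd hpos => ?_
      rw [inner_sub_right] at hpos ⊢
      have h9 := near u hu hd
      rcases le_abs.1 (h8.trans h9) with h10 | h10 <;> linarith
    linarith

end ScaleStep

end ScaleStep

/-! ### Change of direction and the one-step inequality. -/

section ScaleStep

variable {H : Type*} [NormedAddCommGroup H] [InnerProductSpace ℝ H]

/-- The vector f is a common reference: whether d and f form an acute angle does not depend on the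
direction used to test it. -/
lemma inner_pos_of_inner_pos {b b' d f : H} {σ : ℝ} (hb : ‖b‖ = 1) (hb' : ‖b'‖ = 1)
    (hσ : 0 < σ) (hd : σ ≤ ‖d‖) (hf : σ ≤ ‖f‖) (hbd : ‖perp b d‖ ≤ σ / 50)
    (hbf : ‖perp b f‖ ≤ σ / 50) (hbd' : ‖perp b' d‖ ≤ σ / 50) (hbf' : ‖perp b' f‖ ≤ σ / 50)
    (hif : 0 ≤ (inner ℝ b f : ℝ)) (hif' : 0 ≤ (inner ℝ b' f : ℝ))
    (hid : 0 < (inner ℝ b' d : ℝ)) : 0 < (inner ℝ b d : ℝ) := by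
  obtain ⟨h1, -, h3⟩ := inner_pos_iff_mul_pos hb' hσ hd hbd' hf hbf'
  obtain ⟨-, h2', h3'⟩ := inner_pos_iff_mul_pos hb hσ hd hbd hf hbf
  have k1 := h1 (lt_of_le_of_ne (mul_nonneg hid.le hif') h3.symm)
  by_contra hcon
  exact absurd (h2' (lt_of_le_of_ne (mul_nonpos_of_nonpos_of_nonneg (not_lt.1 hcon) hif) h3'))
    (not_lt.2 k1.le)

namespace ScaleStep

variable {C ρ ρ' : ℝ} {P Q : Finset H} {a : H → ℝ} {e : H → H}

/-- Projecting to another line that is almost parallel changes overlaps only quadratically. -/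
lemma cellOverlap_le_of_inner_nonneg (h : ScaleStep C ρ ρ' P Q a e) {b b' v w w₀ : H} {t : ℝ}
    (hb : ‖b‖ = 1) (hb' : ‖b'‖ = 1) (hv : v ∈ P) (hw : w ∈ Q) (hw₀ : w₀ ∈ Q) (hne : w ≠ w₀)
    (hwv : dist w v ≤ 30 * C * ρ) (hwv₀ : dist w₀ v ≤ 30 * C * ρ) (ht : t ≤ 1 / 100)
    (hf : ∀ x, x ∈ P ∨ x ∈ Q → ∀ y, y ∈ P ∨ y ∈ Q → dist x v ≤ 100 * C * ρ →
      dist y v ≤ 100 * C * ρ → ‖perp b (x - y)‖ ≤ 2 * t * ρ')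
    (hf' : ∀ x, x ∈ P ∨ x ∈ Q → ∀ y, y ∈ P ∨ y ∈ Q → dist x v ≤ 100 * C * ρ →
      dist y v ≤ 100 * C * ρ → ‖perp b' (x - y)‖ ≤ 2 * t * ρ')
    (hi : 0 ≤ (inner ℝ b (w - w₀) : ℝ)) (hi' : 0 ≤ (inner ℝ b' (w - w₀) : ℝ)) :
    cellOverlap b P (10 * C * ρ) Q (10 * C * ρ') w v ≤
      cellOverlap b' P (10 * C * ρ) Q (10 * C * ρ') w v + 1000 * C * ρ * t ^ 2 := by
  have hC := h.mul_pos
  have hC' := h.mul_pos'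
  have hCC := h.two_mul_mul_le
  have hρ := h.pos
  have hs : 0 ≤ 10 * C * ρ := by linarith
  have hs' : 0 ≤ 10 * C * ρ' := by linarith
  have hτ : 2 * t * ρ' ≤ ρ' / 50 := by nlinarith
  have hff : ρ' ≤ ‖w - w₀‖ := (h.sepQ w hw w₀ hw₀ hne).trans_eq (dist_eq_norm _ _)
  have pf := hf w (Or.inr hw) w₀ (Or.inr hw₀) (by linarith) (by linarith)
  have pf' := hf' w (Or.inr hw) w₀ (Or.inr hw₀) (by linarith) (by linarith)
  have diff : ∀ x, x ∈ P ∨ x ∈ Q → ∀ y, y ∈ P ∨ y ∈ Q → dist x v ≤ 100 * C * ρ →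
      dist y v ≤ 100 * C * ρ → dist x y ≤ 30 * C * ρ →
      |(inner ℝ b (x - y) : ℝ) - inner ℝ b' (x - y)| ≤ 500 * C * ρ * t ^ 2 := by
    intro x hx y hy hxv hyv hxy
    have := abs_inner_sub_inner_le hb hb' hρ hff pf pf' hi hi' (d := x - y)
      ((dist_eq_norm x y).symm.le.trans hxy) (hf x hx y hy hxv hyv)
    refine this.trans ?_
    -- This is `abs_inner_sub_inner_le` with M = 30Cρ, τ = 2tρ', σ = ρ'; the term 12ρ' is absorbed
    -- by raising 480 to 500.
    have e1 : 4 * (30 * C * ρ) * (2 * t * ρ' / ρ') ^ 2 + 3 * (2 * t * ρ') ^ 2 / ρ' =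
      (480 * (C * ρ) + 12 * ρ') * t ^ 2 := by field_simp; ring
    rw [e1]
    have : 480 * (C * ρ) + 12 * ρ' ≤ 500 * C * ρ := by linarith [h.le_mul, h.two_mul_le]
    gcongr
  have pos : ∀ x, x ∈ P ∨ x ∈ Q → ∀ y, y ∈ P ∨ y ∈ Q → dist x v ≤ 100 * C * ρ →
      dist y v ≤ 100 * C * ρ → ρ' ≤ dist x y →
      (0 < (inner ℝ b (x - y) : ℝ) ↔ 0 < (inner ℝ b' (x - y) : ℝ)) := by
    intro x hx y hy hxv hyv hxy
    rw [dist_eq_norm] at hxy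
    have k := (hf x hx y hy hxv hyv).trans hτ
    have k' := (hf' x hx y hy hxv hyv).trans hτ
    exact ⟨inner_pos_of_inner_pos hb' hb hρ hxy hff k' (pf'.trans hτ) k (pf.trans hτ) hi' hi,
      inner_pos_of_inner_pos hb hb' hρ hxy hff k (pf.trans hτ) k' (pf'.trans hτ) hi hi'⟩
  have hη : 0 ≤ 500 * C * ρ * t ^ 2 := by
    have : 0 ≤ C * ρ * t ^ 2 := by positivity
    linarith
  -- A common estimate for the four half gaps.
  have gaps : ∀ (V : Finset H) (s : ℝ) (y : H), 0 ≤ s → (∀ x ∈ V, x ∈ P ∨ x ∈ Q) →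
      y ∈ V → (∀ x ∈ V, x ≠ y → ρ' ≤ dist x y) → 2 * s ≤ 20 * C * ρ → dist y v ≤ 30 * C * ρ →
      halfGap b V s y ≤ halfGap b' V s y + 500 * C * ρ * t ^ 2 / 2 ∧
      halfGap (-b) V s y ≤ halfGap (-b') V s y + 500 * C * ρ * t ^ 2 / 2 := by
    intro V s y hs hV hy hsep h2s hyv
    have aux : ∀ u ∈ V, dist u y ≤ 2 * s → dist u v ≤ 100 * C * ρ := by
      intro u _ hd
      linarith [dist_triangle u y v]
    constructor
    · refine halfGap_le_halfGap_add hs hη fun u hu hd hip => ?_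
      have hne' : u ≠ y := by rintro rfl; simp at hip
      refine ⟨(pos u (hV u hu) y (hV y hy) (aux u hu hd) (by linarith) (hsep u hu hne')).2 hip, ?_⟩
      have := abs_le.1 (diff u (hV u hu) y (hV y hy) (aux u hu hd) (by linarith) (by linarith))
      linarith
    · refine halfGap_le_halfGap_add hs hη fun u hu hd hip => ?_
      have hne' : u ≠ y := by rintro rfl; simp at hip
      have e1 : ∀ c : H, (inner ℝ (-c) (u - y) : ℝ) = inner ℝ c (y - u) := by
        intro c; rw [inner_neg_left, ← inner_neg_right, neg_sub]
      rw [e1] at hip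
      rw [e1, e1]
      rw [dist_comm] at hd
      have hd' : dist u v ≤ 100 * C * ρ := aux u hu (by rwa [dist_comm])
      refine ⟨(pos y (hV y hy) u (hV u hu) (by linarith) hd'
        ((hsep u hu hne').trans_eq (dist_comm _ _))).2 hip, ?_⟩
      have := abs_le.1 (diff y (hV y hy) u (hV u hu) (by linarith) hd' (by linarith))
      linarith
  obtain ⟨g1, g2⟩ := gaps Q (10 * C * ρ') w hs' (fun _ => Or.inr) hw
    (fun x hx hxy => h.sepQ x hx w hw hxy) (by linarith) hwv
  obtain ⟨g3, g4⟩ := gaps P (10 * C * ρ) v hs (fun _ => Or.inl) hv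
    (fun x hx hxy => by linarith [h.sepP x hx v hv hxy, h.two_mul_le]) (by linarith)
    (by rw [dist_self]; linarith)
  have hd := diff v (Or.inl hv) w (Or.inr hw) (by rw [dist_self]; linarith) (by linarith)
    (by rwa [dist_comm])
  rw [inner_sub_right, inner_sub_right] at hd
  have := overlap_le_overlap_add hη hd g2 g1 g4 g3
  unfold cellOverlap
  linarith

lemma cellOverlap_le (h : ScaleStep C ρ ρ' P Q a e) {v w w₀ : H} (hv : v ∈ P)
    (hw : w ∈ Q) (hw₀ : w₀ ∈ Q) (hwv : dist w v ≤ 30 * C * ρ) (hwv₀ : dist w₀ v ≤ 30 * C * ρ)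
    (ha : a w ≤ 1 / 100) (ha₀ : a w₀ ≤ a w) :
    cellOverlap (e w) P (10 * C * ρ) Q (10 * C * ρ') w v ≤
      cellOverlap (e w₀) P (10 * C * ρ) Q (10 * C * ρ') w v + 1000 * C * ρ * a w ^ 2 := by
  have hC := h.mul_pos
  by_cases hne : w = w₀
  · subst hne
    have : 0 ≤ C * ρ * a w ^ 2 := by positivity
    linarith
  have tri : ∀ x z, dist x v ≤ 100 * C * ρ → dist z v ≤ 30 * C * ρ → dist x z ≤ 132 * C * ρ := by
    intro x z hx hz
    have := dist_triangle x v z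
    rw [dist_comm v z] at this
    linarith
  have f1 : ∀ x, x ∈ P ∨ x ∈ Q → ∀ y, y ∈ P ∨ y ∈ Q → dist x v ≤ 100 * C * ρ →
      dist y v ≤ 100 * C * ρ → ‖perp (e w) (x - y)‖ ≤ 2 * a w * ρ' := fun x hx y hy hxv hyv =>
    h.flat w hw x hx y hy (tri x w hxv hwv) (tri y w hyv hwv)
  have f2 : ∀ x, x ∈ P ∨ x ∈ Q → ∀ y, y ∈ P ∨ y ∈ Q → dist x v ≤ 100 * C * ρ →
      dist y v ≤ 100 * C * ρ → ‖perp (e w₀) (x - y)‖ ≤ 2 * a w * ρ' := by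
    intro x hx y hy hxv hyv
    refine (h.flat w₀ hw₀ x hx y hy (tri x w₀ hxv hwv₀) (tri y w₀ hyv hwv₀)).trans ?_
    have := h.pos
    gcongr
  -- Each direction is reversed if necessary so that both have a nonnegative component along w - w₀.
  have orient : ∀ c : H, ‖c‖ = 1 → (∀ x, x ∈ P ∨ x ∈ Q → ∀ y, y ∈ P ∨ y ∈ Q →
      dist x v ≤ 100 * C * ρ → dist y v ≤ 100 * C * ρ → ‖perp c (x - y)‖ ≤ 2 * a w * ρ') →
      ∃ b : H, ‖b‖ = 1 ∧ (∀ x, x ∈ P ∨ x ∈ Q → ∀ y, y ∈ P ∨ y ∈ Q →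
      dist x v ≤ 100 * C * ρ → dist y v ≤ 100 * C * ρ → ‖perp b (x - y)‖ ≤ 2 * a w * ρ') ∧
      0 ≤ (inner ℝ b (w - w₀) : ℝ) ∧ cellOverlap b P (10 * C * ρ) Q (10 * C * ρ') w v =
        cellOverlap c P (10 * C * ρ) Q (10 * C * ρ') w v := by
    intro c hc hcf
    rcases le_total 0 (inner ℝ c (w - w₀) : ℝ) with h1 | h1
    · exact ⟨c, hc, hcf, h1, rfl⟩
    · refine ⟨-c, by simpa using hc, by simpa only [perp_neg_left] using hcf, ?_,
        cellOverlap_neg _ _ _ _ _ _ _⟩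
      rw [inner_neg_left]; linarith
  obtain ⟨b, hb, hbf, hbi, hbo⟩ := orient (e w) (h.unit w hw) f1
  obtain ⟨b', hb', hbf', hbi', hbo'⟩ := orient (e w₀) (h.unit w₀ hw₀) f2
  rw [← hbo, ← hbo']
  exact h.cellOverlap_le_of_inner_nonneg hb hb' hv hw hw₀ hne hwv hwv₀ ha hbf hbf' hbi hbi'

/-- Almost collinear separated points are few. -/
lemma _root_.card_le_of_flat {T : Finset H} {b c : H} {σ M : ℝ} (hb : ‖b‖ = 1) (hσ : 0 < σ)
    (hM : 0 ≤ M) (hsep : ∀ u ∈ T, ∀ v ∈ T, u ≠ v → σ ≤ dist u v)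
    (hflat : ∀ u ∈ T, ∀ v ∈ T, ‖perp b (u - v)‖ ≤ σ / 50) (hT : ∀ u ∈ T, dist u c ≤ M * σ) :
    (T.card : ℝ) ≤ 3 * M + 1 := by
  have h := card_mul_le_of_separated T (fun u => (inner ℝ b u : ℝ)) (σ := 99 / 100 * σ)
    (M := M * σ) (c := inner ℝ b c) (by positivity) (by positivity) (by
      intro u hu v hv huv
      have h1 := hsep u hu v hv huv
      have := le_abs_inner_of_norm_perp_le hb (h1.trans_eq (dist_eq_norm _ _)) (hflat u hu v hv)
      rw [← dist_eq_norm, inner_sub_right] at this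
      linarith) (by
      intro u hu
      rw [← inner_sub_right]
      exact (abs_inner_le_norm_of_unit hb _).trans ((dist_eq_norm u c).symm.le.trans (hT u hu)))
  have h2 : (T.card : ℝ) * (99 / 100) ≤ 2 * M + 99 / 100 := by
    have : (T.card : ℝ) * (99 / 100) * σ ≤ (2 * M + 99 / 100) * σ := by linarith
    exact le_of_mul_le_mul_right this hσ
  linarith

/-- The total local length grows in one step at most by the sum of the squared errors, and it
drops at every endpoint around which the next scale is flat. -/
theorem sum_locLen_le (h : ScaleStep C ρ ρ' P Q a e) {G : Finset H} (hGP : G ⊆ P)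
    (hG : ∀ v ∈ G, (∃ w ∈ Q, dist w v ≤ C * ρ ∧ a w ≤ 1 / 100) ∧ IsEndpoint P (10 * C * ρ) v) :
    ∑ w ∈ Q, locLen Q (10 * C * ρ') w + ρ * G.card ≤
      ∑ v ∈ P, locLen P (10 * C * ρ) v + 200000 * C ^ 2 * ∑ w ∈ Q, a w ^ 2 * ρ := by
  classical
  have hC := h.mul_pos
  have hC' := h.mul_pos'
  have hCC := h.two_mul_mul_le
  have hρ := h.pos
  have hρ₁ := h.pos'
  have h1C := h.one_lt
  have hs : 0 ≤ 10 * C * ρ := by linarith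
  have hs' : 0 ≤ 10 * C * ρ' := by linarith
  -- To each `v` belongs one direction, that of the nearby point of `Q` with least error. All cells
  -- near `v` are then compared in the same projection, and changing from the direction of `w` costs
  -- only a multiple of `a w ^ 2`. If `Q` has no point near `v`, the value is arbitrary.
  have hch : ∀ v, ∃ w₀, ∀ w ∈ Q, dist w v ≤ 30 * C * ρ →
      w₀ ∈ Q ∧ dist w₀ v ≤ 30 * C * ρ ∧ a w₀ ≤ a w := by
    intro v
    by_cases hne : (Q.filter fun w => dist w v ≤ 30 * C * ρ).Nonempty
    · obtain ⟨w₀, hw₀, hmin⟩ := (Q.filter fun w => dist w v ≤ 30 * C * ρ).exists_min_image a hne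
      obtain ⟨h1, h2⟩ := Finset.mem_filter.1 hw₀
      exact ⟨w₀, fun w hw hwv => ⟨h1, h2, hmin w (Finset.mem_filter.2 ⟨hw, hwv⟩)⟩⟩
    · refine ⟨0, fun w hw hwv => absurd ⟨w, Finset.mem_filter.2 ⟨hw, hwv⟩⟩ hne⟩
  choose w₀ hw₀ using hch
  set ov : H → H → ℝ := fun w v =>
    cellOverlap (e (w₀ v)) P (10 * C * ρ) Q (10 * C * ρ') w v with hov
  set F := Q.filter fun w => a w ≤ 1 / 100 with hF
  have hFQ : ∀ w ∈ F, w ∈ Q ∧ a w ≤ 1 / 100 := fun w hw => Finset.mem_filter.1 hw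
  -- points of `Q` without a flat neighbourhood
  have hbad : ∀ w ∈ Q, w ∉ F →
      locLen Q (10 * C * ρ') w ≤ 200000 * C ^ 2 * (a w ^ 2 * ρ) := by
    intro w hw hwF
    have h1 : 1 / 100 < a w := by
      by_contra hcon
      exact hwF (Finset.mem_filter.2 ⟨hw, not_lt.1 hcon⟩)
    have h2 : (1 : ℝ) ≤ 10000 * a w ^ 2 := by nlinarith
    refine (locLen_le_scale hs' hw).trans ?_
    have h3 : C * ρ ≤ C ^ 2 * ρ := by nlinarith
    have h4 : C ^ 2 * ρ * 1 ≤ C ^ 2 * ρ * (10000 * a w ^ 2) := by gcongr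
    linarith
  -- points of `Q` with a flat neighbourhood
  have hflat : ∀ w ∈ F, locLen Q (10 * C * ρ') w ≤
      ∑ v ∈ P with dist w v ≤ 30 * C * ρ, ov w v + 200000 * C ^ 2 * (a w ^ 2 * ρ) := by
    intro w hwF
    obtain ⟨hw, haw⟩ := hFQ w hwF
    have ha0 := h.nonneg w hw
    have hfl : FlatNear C ρ ρ' P Q (e w) w := h.flatNear hw (by rw [dist_self]; linarith) haw
    have h1 := locLen_le_halfGap_add_halfGap (V := Q) (s := 10 * C * ρ') (v := w) (σ := ρ')
      (τ := 2 * a w * ρ') (h.unit w hw) hs' hρ hw (by nlinarith)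
      (fun u hu huw => h.sepQ u hu w hw huw) (fun u hu hd =>
        h.flat w hw u (Or.inr hu) w (Or.inr hw) (by linarith) (by rw [dist_self]; linarith))
    have h2 := h.le_sum_cellOverlap (h.unit w hw) hfl hw
    have h3 : ∑ v ∈ P with dist w v ≤ 30 * C * ρ,
        cellOverlap (e w) P (10 * C * ρ) Q (10 * C * ρ') w v ≤
        ∑ v ∈ P with dist w v ≤ 30 * C * ρ, (ov w v + 1000 * C * ρ * a w ^ 2) := by
      refine Finset.sum_le_sum fun v hv => ?_
      obtain ⟨hvP, hwv⟩ := Finset.mem_filter.1 hv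
      obtain ⟨k1, k2, k3⟩ := hw₀ v w hw hwv
      exact h.cellOverlap_le hvP hw k1 hwv k2 haw k3
    rw [Finset.sum_add_distrib, Finset.sum_const, nsmul_eq_mul] at h3
    -- At most 90C + 1 ≤ 100C cells of `P` are involved, each costing 1000Cρ·a²; hence the factor C²
    -- in the result.
    have h4 : ((P.filter fun v => dist w v ≤ 30 * C * ρ).card : ℝ) ≤ 3 * (30 * C) + 1 := by
      refine card_le_of_flat (h.unit w hw) hρ₁ (by linarith) (c := w) ?_ ?_ ?_
      · intro u hu v hv huv
        exact h.sepP u (Finset.mem_filter.1 hu).1 v (Finset.mem_filter.1 hv).1 huv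
      · intro u hu v hv
        have hu' := Finset.mem_filter.1 hu
        have hv' := Finset.mem_filter.1 hv
        have := hfl u (Or.inl hu'.1) v (Or.inl hv'.1) (by rw [dist_comm]; linarith)
          (by rw [dist_comm]; linarith)
        linarith [h.two_mul_le]
      · intro u hu
        rw [dist_comm]; exact (Finset.mem_filter.1 hu).2
    have h5 : ((P.filter fun v => dist w v ≤ 30 * C * ρ).card : ℝ) * (1000 * C * ρ * a w ^ 2) ≤
        (100 * C) * (1000 * C * ρ * a w ^ 2) := by
      apply mul_le_mul_of_nonneg_right (by linarith)
      have : 0 ≤ C * ρ * a w ^ 2 := by positivity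
      linarith
    have h6 : (2 * a w * ρ') ^ 2 / ρ' = 4 * (a w ^ 2 * ρ') := by field_simp; ring
    have h7 : a w ^ 2 * ρ' ≤ C ^ 2 * (a w ^ 2 * ρ) := by
      have : a w ^ 2 * ρ' ≤ a w ^ 2 * ρ := by gcongr; linarith [h.two_mul_le]
      have : 1 * (a w ^ 2 * ρ) ≤ C ^ 2 * (a w ^ 2 * ρ) := by
        gcongr
        nlinarith
      linarith
    have h8 : 0 ≤ C ^ 2 * (a w ^ 2 * ρ) := by positivity
    linarith
  -- points of `P`
  have hP : ∀ v ∈ P, ∑ w ∈ F with dist w v ≤ 30 * C * ρ, ov w v + (if v ∈ G then ρ else 0) ≤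
      locLen P (10 * C * ρ) v := by
    intro v hv
    by_cases hne : (F.filter fun w => dist w v ≤ 30 * C * ρ).Nonempty
    · obtain ⟨w, hw⟩ := hne
      obtain ⟨hwF, hwv⟩ := Finset.mem_filter.1 hw
      obtain ⟨hwQ, haw⟩ := hFQ w hwF
      obtain ⟨k1, k2, k3⟩ := hw₀ v w hwQ hwv
      have hb := h.unit _ k1
      have hfl := h.flatNear k1 k2 (k3.trans haw)
      have flP : ∀ u ∈ P, dist u v ≤ 10 * C * ρ → ‖perp (e (w₀ v)) (u - v)‖ ≤ ρ / 50 := by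
        intro u hu hd
        have := hfl u (Or.inl hu) v (Or.inl hv) (by linarith) (by rw [dist_self]; linarith)
        linarith [h.two_mul_le]
      have hlen := halfGap_add_halfGap_le_locLen hb hs hρ₁ hv (fun u hu huv => h.sepP u hu v hv huv)
        flP
      have hT : (F.filter fun w => dist w v ≤ 30 * C * ρ) ⊆ Q := fun x hx =>
        (hFQ x (Finset.mem_filter.1 hx).1).1
      obtain ⟨s1, s2⟩ := h.sum_cellOverlap_le hb hfl hv hT
        (fun x hx => (Finset.mem_filter.1 hx).2)
      -- The reversed direction serves endpoints whose neighbours project to the positive side.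
      obtain ⟨-, s3⟩ := h.sum_cellOverlap_le (b := -e (w₀ v)) (by simpa using hb) hfl.neg hv hT
        (fun x hx => (Finset.mem_filter.1 hx).2)
      simp only [cellOverlap_neg, neg_neg] at s3
      by_cases hvG : v ∈ G
      · rw [if_pos hvG]
        have hend := (hG v hvG).2
        by_cases hside : ∀ z ∈ P, dist z v ≤ 10 * C * ρ → (inner ℝ (e (w₀ v)) (z - v) : ℝ) ≤ 0
        · linarith [s2 hside]
        · push Not at hside
          obtain ⟨z, hz, hzv, hzi⟩ := hside
          have hzne : z ≠ v := by rintro rfl; simp at hzi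
          refine le_trans ?_ hlen
          rw [add_comm (halfGap _ _ _ _)]
          refine s3 fun z' hz' hzv' => ?_
          by_cases hzne' : z' = v
          · simp [hzne']
          have k4 := hend z hz z' hz' hzne hzne' hzv hzv'
          rw [inner_neg_left]
          have k5 := (inner_pos_iff_mul_pos hb hρ₁
            ((h.sepP z hz v hv hzne).trans_eq (dist_eq_norm _ _)) (flP z hz hzv)
            ((h.sepP z' hz' v hv hzne').trans_eq (dist_eq_norm _ _)) (flP z' hz' hzv')).2.1
          by_contra hcon
          exact absurd (k5 (mul_neg_of_pos_of_neg hzi (by linarith))) (not_lt.2 k4.le)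
      · rw [if_neg hvG]
        linarith
    · have hvG : v ∉ G := by
        intro hvG
        obtain ⟨⟨w, hw, hd, haw⟩, -⟩ := hG v hvG
        exact hne ⟨w, Finset.mem_filter.2 ⟨Finset.mem_filter.2 ⟨hw, haw⟩, by linarith⟩⟩
      rw [if_neg hvG, Finset.not_nonempty_iff_eq_empty.1 hne, Finset.sum_empty, add_zero]
      exact h.pos'.le.trans (le_locLen_of_separated hv (by linarith [h.le_mul])
        fun u hu huv => h.sepP u hu v hv huv)
  have hsplit : ∑ w ∈ Q, locLen Q (10 * C * ρ') w ≤
      ∑ w ∈ F, ∑ v ∈ P with dist w v ≤ 30 * C * ρ, ov w v +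
        200000 * C ^ 2 * ∑ w ∈ Q, a w ^ 2 * ρ := by
    rw [Finset.mul_sum, hF, Finset.sum_filter, ← Finset.sum_add_distrib]
    refine Finset.sum_le_sum fun w hw => ?_
    split_ifs with haw
    · exact hflat w (Finset.mem_filter.2 ⟨hw, haw⟩)
    · rw [zero_add]
      exact hbad w hw fun hwF => haw (hFQ w hwF).2
  have hswap : ∑ w ∈ F, ∑ v ∈ P with dist w v ≤ 30 * C * ρ, ov w v =
      ∑ v ∈ P, ∑ w ∈ F with dist w v ≤ 30 * C * ρ, ov w v := by
    simp_rw [Finset.sum_filter]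
    exact Finset.sum_comm
  have hsum := Finset.sum_le_sum hP
  rw [Finset.sum_add_distrib, ← Finset.sum_filter, Finset.filter_mem_eq_inter,
    Finset.inter_eq_right.2 hGP, Finset.sum_const, nsmul_eq_mul] at hsum
  linarith

end ScaleStep

end ScaleStep

/-! ### Counting the bridges. -/

section Spanning

/-- If every class of `E` which is joined by `R` to another class contains a point of `X`, then
at most `#X` pairs suffice to generate, together with `E`, the relation `R`. -/
lemma exists_spanning_pairs {T : Type*} (V : Finset T) {R : T → T → Prop}
    (hR : ∀ a b, R a b → R b a) (X : Finset T) (E : Setoid T)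
    (hX : ∀ a ∈ V, ∀ b ∈ V, R a b → ¬ E a b → ∃ x ∈ X, E x a) :
    ∃ D : Finset (T × T), D.card ≤ X.card ∧ (∀ p ∈ D, p.1 ∈ V ∧ p.2 ∈ V ∧ R p.1 p.2) ∧
      ∀ f : T → Prop, (∀ a b, E a b → (f a ↔ f b)) → (∀ p ∈ D, (f p.1 ↔ f p.2)) →
        ∀ a ∈ V, ∀ b ∈ V, R a b → (f a ↔ f b) := by
  classical
  induction hn : X.card generalizing X E with
  | zero =>
    refine ⟨∅, by simp, by simp, fun f hf _ a ha b hb hab => hf a b ?_⟩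
    by_contra hE
    obtain ⟨x, hx, -⟩ := hX a ha b hb hab hE
    rw [Finset.card_eq_zero.1 hn] at hx
    simp at hx
  | succ n ih =>
    by_cases hall : ∀ a ∈ V, ∀ b ∈ V, R a b → E a b
    · exact ⟨∅, by simp, by simp, fun f hf _ a ha b hb hab => hf a b (hall a ha b hb hab)⟩
    push Not at hall
    obtain ⟨a, ha, b, hb, hab, hE⟩ := hall
    obtain ⟨x, hx, hxa⟩ := hX a ha b hb hab hE
    obtain ⟨y, hy, hyb⟩ := hX b hb a ha (hR a b hab) fun h => hE (E.symm h)
    have hxy : y ≠ x := by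
      rintro rfl
      exact hE (E.trans (E.symm hxa) hyb)
    set r : T → T → Prop := fun p q => E p q ∨ (p = a ∧ q = b) with hr
    set E' : Setoid T := Relation.EqvGen.setoid r with hE'
    have hle : ∀ p q, E p q → E' p q := fun p q h => Relation.EqvGen.rel _ _ (Or.inl h)
    have hab' : E' a b := Relation.EqvGen.rel _ _ (Or.inr ⟨rfl, rfl⟩)
    -- Joining a to b merges classes marked by the distinct points x and y. The mark y suffices for
    -- the merged class, so each pair uses up one element of `X`.
    obtain ⟨D, hD1, hD2, hD3⟩ := ih (X.erase x) E' (by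
      intro p hp q hq hpq hnE
      obtain ⟨z, hz, hzp⟩ := hX p hp q hq hpq fun h => hnE (hle _ _ h)
      by_cases hzx : z = x
      · refine ⟨y, Finset.mem_erase.2 ⟨hxy, hy⟩, ?_⟩
        subst hzx
        exact E'.trans (hle _ _ hyb) (E'.trans (E'.symm hab')
          (E'.trans (E'.symm (hle _ _ hxa)) (hle _ _ hzp)))
      · exact ⟨z, Finset.mem_erase.2 ⟨hzx, hz⟩, hle _ _ hzp⟩)
      (by rw [Finset.card_erase_of_mem hx, hn]; rfl)
    refine ⟨insert (a, b) D, (Finset.card_insert_le _ _).trans (by omega), ?_, ?_⟩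
    · intro p hp
      rcases Finset.mem_insert.1 hp with rfl | hp
      · exact ⟨ha, hb, hab⟩
      · exact hD2 p hp
    · intro f hf hfD
      have hfab : f a ↔ f b := hfD (a, b) (Finset.mem_insert_self _ _)
      refine hD3 f (fun p q hpq => ?_) fun p hp => hfD p (Finset.mem_insert_of_mem hp)
      have hpq' : Relation.EqvGen r p q := hpq
      induction hpq' with
      | rel p q h =>
        rcases h with h | ⟨rfl, rfl⟩
        · exact hf _ _ h
        · exact hfab
      | refl p => exact Iff.rfl
      | symm p q _ ih => exact (ih (by assumption)).symm
      | trans p q s _ _ ih1 ih2 => exact (ih1 (by assumption)).trans (ih2 (by assumption))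

end Spanning

/-! ### Compactness of the union. -/

section CompactUnion

/-- A compact set together with a sequence of compact sets accumulating on it is compact. -/
lemma isCompact_union_iUnion {X : Type*} [PseudoMetricSpace X] {W : Set X} (hW : IsCompact W)
    {K : ℕ → Set X} (hK : ∀ n, IsCompact (K n))
    (h : ∀ ε > 0, ∀ᶠ n in atTop, K n ⊆ Metric.thickening ε W) :
    IsCompact (W ∪ ⋃ n, K n) := by
  classical
  refine isCompact_of_finite_subcover fun {ι} U hU hcov => ?_
  obtain ⟨t, ht⟩ := hW.elim_finite_subcover U hU (Set.subset_union_left.trans hcov)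
  -- The finite subcover of W already covers a thickening, which contains all but finitely many `K
  -- n`.
  obtain ⟨ε, hε, hεt⟩ := hW.exists_thickening_subset_open (isOpen_biUnion fun i _ => hU i) ht
  obtain ⟨N, hN⟩ := eventually_atTop.1 (h ε hε)
  have hfin : IsCompact (⋃ n ∈ Finset.range N, K n) :=
    (Finset.range N).isCompact_biUnion fun n _ => hK n
  obtain ⟨t', ht'⟩ := hfin.elim_finite_subcover U hU (by
    refine Set.Subset.trans ?_ hcov
    intro x hx
    simp only [Set.mem_iUnion] at hx
    obtain ⟨n, -, hx⟩ := hx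
    exact Or.inr (Set.mem_iUnion.2 ⟨n, hx⟩))
  refine ⟨t ∪ t', ?_⟩
  rw [Finset.set_biUnion_union]
  rintro x (hx | hx)
  · exact Or.inl (ht hx)
  · obtain ⟨n, hx⟩ := Set.mem_iUnion.1 hx
    by_cases hn : n < N
    · exact Or.inr (ht' (Set.mem_biUnion (Finset.mem_range.2 hn) hx))
    · exact Or.inl (hεt (hN n (not_lt.1 hn) hx))

end CompactUnion

/-! ### Endpoints at gaps. -/

section Endpoint

variable {H : Type*} [NormedAddCommGroup H] [InnerProductSpace ℝ H]
variable {C ρ ρ' : ℝ} {P Q : Finset H} {a : H → ℝ} {e : H → H}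

/-- In a flat neighbourhood, a class of points of `Q` that is closed under small steps and misses
a point nearby contains an endpoint. -/
lemma ScaleStep.exists_isEndpoint (h : ScaleStep C ρ ρ' P Q a e) (E : Setoid H)
    (hE : ∀ x ∈ Q, ∀ y ∈ Q, dist x y ≤ 10 * C * ρ' → E x y) {u v : H} (hu : u ∈ Q) (hv : v ∈ Q)
    (ha : a v ≤ 1 / 100) (huv : dist u v ≤ 12 * C * ρ) (hvu : ¬ E v u) :
    ∃ z ∈ Q, E v z ∧ IsEndpoint Q (10 * C * ρ') z := by
  classical
  have hC := h.mul_pos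
  have hC' := h.mul_pos'
  have hCC := h.two_mul_mul_le
  have hρ := h.pos
  obtain ⟨b, hb, hbf, hbi⟩ : ∃ b : H, ‖b‖ = 1 ∧ (∀ x ∈ Q, ∀ y ∈ Q, dist x v ≤ 30 * C * ρ →
      dist y v ≤ 30 * C * ρ → ‖perp b (x - y)‖ ≤ ρ' / 50) ∧ 0 ≤ (inner ℝ b (u - v) : ℝ) := by
    have hf : ∀ x ∈ Q, ∀ y ∈ Q, dist x v ≤ 30 * C * ρ →
      dist y v ≤ 30 * C * ρ → ‖perp (e v) (x - y)‖ ≤ ρ' / 50 := fun x hx y hy hxv hyv =>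
      h.flatNear hv (by rw [dist_self]; linarith) ha x (Or.inr hx) y (Or.inr hy) (by linarith)
        (by linarith)
    rcases le_total 0 (inner ℝ (e v) (u - v) : ℝ) with h1 | h1
    · exact ⟨e v, h.unit v hv, hf, h1⟩
    · exact ⟨-e v, by simpa using h.unit v hv, by simpa only [perp_neg_left] using hf, by
        rw [inner_neg_left]; linarith⟩
  rw [inner_sub_right] at hbi
  -- The endpoint is the last point of the class of v on the way to u. A further step from z would
  -- either contradict maximality or jump over u; in the second case u is within one step of z,
  -- hence in the class.
  obtain ⟨z, hz, hmax⟩ := (Q.filter fun z => dist z v ≤ 13 * C * ρ ∧ E v z ∧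
      (inner ℝ b z : ℝ) ≤ inner ℝ b u).exists_max_image (fun z => (inner ℝ b z : ℝ))
    ⟨v, Finset.mem_filter.2 ⟨hv, by rw [dist_self]; linarith, E.refl v, by linarith⟩⟩
  obtain ⟨hzQ, hzv, hEz, hzu⟩ := Finset.mem_filter.1 hz
  have hvz : (inner ℝ b v : ℝ) ≤ inner ℝ b z :=
    hmax v (Finset.mem_filter.2 ⟨hv, by rw [dist_self]; linarith, E.refl v, by linarith⟩)
  have hnear : ∀ y ∈ Q, dist y z ≤ 10 * C * ρ' → dist y v ≤ 30 * C * ρ := fun y _ hyz => by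
    linarith [dist_triangle y z v]
  have hno : ∀ y ∈ Q, dist y z ≤ 10 * C * ρ' → (inner ℝ b (y - z) : ℝ) ≤ 0 := by
    intro y hy hyz
    by_contra hcon
    rw [inner_sub_right] at hcon
    have hEy : E v y := E.trans hEz (hE z hzQ y hy (by rwa [dist_comm]))
    rcases le_or_gt (inner ℝ b y : ℝ) (inner ℝ b u) with h1 | h1
    · have hyv : dist y v ≤ 13 * C * ρ := by
        have h2 := norm_le_abs_inner_add_norm_perp hb (y - v)
        have h3 := hbf y hy v hv (hnear y hy hyz) (by rw [dist_self]; linarith)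
        have h4 := (abs_inner_le_norm_of_unit hb (u - v)).trans
          ((dist_eq_norm u v).symm.le.trans huv)
        rw [inner_sub_right] at h2 h4
        rw [abs_of_nonneg (by linarith)] at h2 h4
        rw [dist_eq_norm]
        linarith [h.le_mul, h.two_mul_le]
      linarith [hmax y (Finset.mem_filter.2 ⟨hy, hyv, hEy, h1⟩)]
    · have hyu : y ≠ u := by rintro rfl; exact hvu hEy
      have h2 := le_abs_inner_of_norm_perp_le hb
        ((h.sepQ y hy u hu hyu).trans_eq (dist_eq_norm _ _))
        (hbf y hy u hu (hnear y hy hyz) (by linarith))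
      rw [inner_sub_right, abs_of_pos (by linarith), ← dist_eq_norm] at h2
      have h3 := h.sepQ y hy u hu hyu
      have h4 := norm_le_abs_inner_add_norm_perp hb (u - z)
      have h5 := hbf u hu z hzQ (by linarith) (by linarith)
      rw [inner_sub_right, abs_of_nonneg (by linarith), ← dist_eq_norm] at h4
      have h6 := (le_abs_self _).trans (abs_inner_le_norm_of_unit hb (y - z))
      rw [inner_sub_right, ← dist_eq_norm] at h6
      exact hvu (E.trans hEz (E.symm (hE u hu z hzQ (by linarith))))
  refine ⟨z, hzQ, hEz, fun y hy y' hy' hyz hyz' hd hd' => ?_⟩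
  have k := inner_pos_iff_mul_pos hb hρ
    ((h.sepQ y hy z hzQ hyz).trans_eq (dist_eq_norm _ _))
    (hbf y hy z hzQ (hnear y hy hd) (by linarith))
    ((h.sepQ y' hy' z hzQ hyz').trans_eq (dist_eq_norm _ _))
    (hbf y' hy' z hzQ (hnear y' hy' hd') (by linarith))
  exact k.1 (lt_of_le_of_ne (mul_nonneg_of_nonpos_of_nonpos (hno y hy hd) (hno y' hy' hd'))
    k.2.2.symm)

end Endpoint

/-! ### The limit set and descent into it. -/

section Chain

/-- The sequence of successive descendants of `v`, starting at generation `k`. -/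
def descend {X : Type*} (c : ℕ → X → X) (k : ℕ) (v : X) : ℕ → X
  | 0 => v
  | n + 1 => c (k + n) (descend c k v n)

/-- Peeling off the first step instead of the last shows that a point and its chosen child have the
same limit. -/
lemma descend_succ' {X : Type*} (c : ℕ → X → X) (k : ℕ) (v : X) (n : ℕ) :
    descend c k v (n + 1) = descend c (k + 1) (c k v) n := by
  induction n with
  | zero => rfl
  | succ n ih =>
    have : descend c k v (n + 1 + 1) = c (k + (n + 1)) (descend c k v (n + 1)) := rfl
    rw [this, ih, show k + (n + 1) = k + 1 + n by omega]
    rfl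

/-- Finite sets whose consecutive members are geometrically close converge in the Hausdorff metric
to a compact set, to which every point of every member descends. -/
theorem exists_hausdorff_limit {X : Type*} [MetricSpace X] [CompleteSpace X] {δ M : ℝ}
    (hδ₀ : 0 < δ) (hδ₁ : δ ≤ 1 / 2) (V : ℕ → Finset X)
    (hne : ∀ k, (V k).Nonempty)
    (hchild : ∀ k, ∀ v ∈ V k, ∃ v' ∈ V (k + 1), dist v' v ≤ M * δ ^ k)
    (hparent : ∀ k, ∀ v ∈ V (k + 1), ∃ v' ∈ V k, dist v' v ≤ M * δ ^ k) :
    ∃ W : Set X, IsCompact W ∧ W.Nonempty ∧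
      Tendsto (fun k => Metric.hausdorffEDist (V k : Set X) W) atTop (𝓝 0) ∧
      (∀ k, ∀ p ∈ W, ∃ v ∈ V k, dist p v ≤ 3 * (M * δ ^ k)) ∧
      ∃ φ : ℕ → X → X, (∀ k, ∀ v ∈ V k, φ k v ∈ W ∧ dist v (φ k v) ≤ 2 * (M * δ ^ k)) ∧
        ∀ k, ∀ v ∈ V k, ∃ v' ∈ V (k + 1), dist v' v ≤ M * δ ^ k ∧ φ (k + 1) v' = φ k v := by
  classical
  have hM : 0 ≤ M := by
    obtain ⟨v, hv⟩ := hne 0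
    obtain ⟨v', -, h⟩ := hchild 0 v hv
    simpa using dist_nonneg.trans h
  have hgeo : ∀ {r : ℝ}, 0 ≤ r → r / (1 - δ) ≤ 2 * r := fun {r} hr => by
    rw [div_le_iff₀ (by linarith)]; nlinarith
  -- The limit comes from completeness of the space of nonempty compact sets; the ambient space need
  -- not be proper.
  let U : ℕ → TopologicalSpace.NonemptyCompacts X := fun k =>
    ⟨⟨V k, (V k).finite_toSet.isCompact⟩, hne k⟩
  have hU : ∀ k, dist (U k) (U (k + 1)) ≤ M * δ ^ k := by
    intro k
    refine Metric.hausdorffDist_le_of_mem_dist (by positivity) ?_ ?_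
    · intro v hv
      obtain ⟨v', hv', h⟩ := hchild k v hv
      exact ⟨v', hv', by rwa [dist_comm]⟩
    · intro v hv
      obtain ⟨v', hv', h⟩ := hparent k v hv
      exact ⟨v', hv', by rwa [dist_comm]⟩
  have hδ : δ < 1 := by linarith
  obtain ⟨L, hL⟩ := cauchySeq_tendsto_of_complete (cauchySeq_of_le_geometric δ M hδ hU)
  have hdist : ∀ k, Metric.hausdorffDist (V k : Set X) (L : Set X) ≤ 2 * (M * δ ^ k) := fun k =>
    (dist_le_of_le_geometric_of_tendsto δ M hδ hU hL k).trans (hgeo (by positivity))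
  have hfin : ∀ k, Metric.hausdorffEDist (V k : Set X) (L : Set X) ≠ ⊤ := fun k =>
    Metric.hausdorffEDist_ne_top_of_nonempty_of_bounded (hne k) L.nonempty
      (V k).finite_toSet.isBounded L.isCompact.isBounded
  have hclose : ∀ k, ∀ p ∈ (L : Set X), ∃ v ∈ V k, dist p v ≤ 2 * (M * δ ^ k) := by
    intro k p hp
    have h1 : Metric.infDist p (V k : Set X) ≤ 2 * (M * δ ^ k) := by
      refine (Metric.infDist_le_hausdorffDist_of_mem hp ?_).trans
        ((Metric.hausdorffDist_comm).le.trans (hdist k))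
      rw [Metric.hausdorffEDist_comm]; exact hfin k
    obtain ⟨v, hv, h⟩ := (V k).finite_toSet.isCompact.exists_infDist_eq_dist (hne k) p
    exact ⟨v, hv, h ▸ h1⟩
  choose! c hcV hcd using hchild
  have hdes : ∀ k v, v ∈ V k → ∀ n, descend c k v n ∈ V (k + n) := by
    intro k v hv n
    induction n with
    | zero => exact hv
    | succ n ih => exact hcV (k + n) _ ih
  have hstep : ∀ k v, v ∈ V k → ∀ n,
      dist (descend c k v n) (descend c k v (n + 1)) ≤ M * δ ^ k * δ ^ n := by
    intro k v hv n
    rw [dist_comm, mul_assoc, ← pow_add]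
    exact hcd (k + n) _ (hdes k v hv n)
  have hlim : ∀ k v, ∃ p, v ∈ V k → Tendsto (descend c k v) atTop (𝓝 p) := by
    intro k v
    by_cases hv : v ∈ V k
    · obtain ⟨p, hp⟩ := cauchySeq_tendsto_of_complete
        (cauchySeq_of_le_geometric δ _ hδ (hstep k v hv))
      exact ⟨p, fun _ => hp⟩
    · exact ⟨v, fun h => absurd h hv⟩
  choose φ hφ using hlim
  refine ⟨L, L.isCompact, L.nonempty, ?_, fun k p hp => ?_, φ, fun k v hv => ⟨?_, ?_⟩,
    fun k v hv => ⟨c k v, hcV k v hv, hcd k v hv, ?_⟩⟩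
  · have := tendsto_iff_edist_tendsto_0.1 hL
    exact this
  · obtain ⟨v, hv, h⟩ := hclose k p hp
    exact ⟨v, hv, h.trans (by nlinarith [mul_nonneg hM (pow_nonneg hδ₀.le k)])⟩
  · rw [L.isCompact.isClosed.mem_iff_infDist_zero L.nonempty]
    have h1 : Tendsto (fun n => Metric.infDist (descend c k v n) (L : Set X)) atTop
        (𝓝 (Metric.infDist (φ k v) (L : Set X))) :=
      ((Metric.continuous_infDist_pt _).tendsto _).comp (hφ k v hv)
    have h2 : Tendsto (fun n => 2 * (M * δ ^ (k + n))) atTop (𝓝 0) := by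
      have := ((tendsto_pow_atTop_nhds_zero_of_lt_one hδ₀.le hδ).comp
        (tendsto_add_atTop_nat k)).const_mul (2 * M)
      simp only [mul_zero] at this
      refine this.congr fun n => ?_
      simp only [Function.comp]
      rw [add_comm n k]; ring
    refine tendsto_nhds_unique h1 (squeeze_zero (fun _ => Metric.infDist_nonneg) (fun n => ?_) h2)
    exact (Metric.infDist_le_hausdorffDist_of_mem (hdes k v hv n) (hfin _)).trans (hdist _)
  · exact (dist_le_of_le_geometric_of_tendsto₀ δ _ hδ (hstep k v hv) (hφ k v hv)).trans
      (hgeo (by positivity))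
  · have h1 : Tendsto (fun n => descend c k v (n + 1)) atTop (𝓝 (φ k v)) :=
      (hφ k v hv).comp (tendsto_add_atTop_nat 1)
    simp_rw [descend_succ'] at h1
    exact tendsto_nhds_unique (hφ (k + 1) (c k v) (hcV k v hv)) h1

end Chain

/-! ### Connectedness across scales. -/

section Bridges

/-- A compact set, together with segments that join, at every scale, the coarse pieces of its
discrete approximations, is connected. Here `φ k` moves the `k`-th approximation into the set. -/
theorem isPreconnected_union_segments {H : Type*} [NormedAddCommGroup H] [NormedSpace ℝ H]
    {W : Set H} {V : ℕ → Finset H} {φ : ℕ → H → H} {D : ℕ → Finset (H × H)} {s t R : ℕ → ℝ}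
    (ht : Tendsto t atTop (𝓝 0))
    (hcpt : IsCompact (W ∪ ⋃ k, ⋃ p ∈ D k, segment ℝ (φ (k + 1) p.1) (φ (k + 1) p.2)))
    (hφW : ∀ k, ∀ v ∈ V k, φ k v ∈ W)
    (hφs : ∀ k, ∀ u ∈ V k, ∀ v ∈ V k, dist u v ≤ s k → dist (φ k u) (φ k v) ≤ t k)
    (hWφ : ∀ k, ∀ p ∈ W, ∃ v ∈ V k, dist p (φ k v) ≤ t k)
    (hchild : ∀ k, ∀ u ∈ V k, ∀ v ∈ V k, dist u v ≤ s k →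
      ∃ u' ∈ V (k + 1), ∃ v' ∈ V (k + 1), φ (k + 1) u' = φ k u ∧ φ (k + 1) v' = φ k v ∧
        dist u' v' ≤ R k)
    (hparent : ∀ k, ∀ v ∈ V (k + 1), ∃ u ∈ V k, ∃ u' ∈ V (k + 1), φ (k + 1) u' = φ k u ∧
      dist v u' ≤ R k)
    (hbase : ∀ u ∈ V 1, ∀ v ∈ V 1, dist u v ≤ R 0)
    (hDV : ∀ k, ∀ p ∈ D k, p.1 ∈ V (k + 1) ∧ p.2 ∈ V (k + 1))
    (hD : ∀ k, ∀ f : H → Prop,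
      (∀ x ∈ V (k + 1), ∀ y ∈ V (k + 1), dist x y ≤ s (k + 1) → (f x ↔ f y)) →
      (∀ p ∈ D k, (f p.1 ↔ f p.2)) →
      ∀ x ∈ V (k + 1), ∀ y ∈ V (k + 1), dist x y ≤ R k → (f x ↔ f y)) :
    IsPreconnected (W ∪ ⋃ k, ⋃ p ∈ D k, segment ℝ (φ (k + 1) p.1) (φ (k + 1) p.2)) := by
  set Γ := W ∪ ⋃ k, ⋃ p ∈ D k, segment ℝ (φ (k + 1) p.1) (φ (k + 1) p.2) with hΓ
  have hseg : ∀ k, ∀ p ∈ D k, segment ℝ (φ (k + 1) p.1) (φ (k + 1) p.2) ⊆ Γ := by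
    intro k p hp x hx
    exact Or.inr (Set.mem_iUnion.2 ⟨k, Set.mem_biUnion hp hx⟩)
  rw [isPreconnected_iff_subset_of_disjoint_closed]
  intro A B hA hB hAB hdisj
  have hdj : Disjoint (Γ ∩ A) (Γ ∩ B) := by
    rw [Set.disjoint_iff_inter_eq_empty, ← Set.inter_inter_distrib_left]; exact hdisj
  obtain ⟨η, hη, hthick⟩ := hdj.exists_thickenings (hcpt.inter_right hA)
    (hcpt.isClosed.inter hB)
  have hmem : ∀ x ∈ Γ, x ∉ A → x ∈ B := fun x hx hxA => (hAB hx).resolve_left hxA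
  have hnot : ∀ x ∈ Γ, x ∈ A → x ∉ B := fun x hx hxA hxB =>
    Set.disjoint_left.1 hdj ⟨hx, hxA⟩ ⟨hx, hxB⟩
  have hfar : ∀ x ∈ Γ, ∀ y ∈ Γ, x ∈ A → dist x y < η → y ∈ A := by
    intro x hx y hy hxA hd
    by_contra hyA
    refine Set.disjoint_left.1 hthick (Metric.mem_thickening_iff.2 ⟨x, ⟨hx, hxA⟩, ?_⟩)
      (Metric.self_subset_thickening hη _ ⟨hy, hmem y hy hyA⟩)
    rwa [dist_comm]
  have hfar' : ∀ x ∈ Γ, ∀ y ∈ Γ, dist x y < η → (x ∈ A ↔ y ∈ A) := fun x hx y hy hd =>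
    ⟨fun h => hfar x hx y hy h hd, fun h => hfar y hy x hx h (by rwa [dist_comm])⟩
  have hWΓ : W ⊆ Γ := Set.subset_union_left
  have hsegA : ∀ k, ∀ p ∈ D k, (φ (k + 1) p.1 ∈ A ↔ φ (k + 1) p.2 ∈ A) ∧
      (φ (k + 1) p.1 ∈ A → segment ℝ (φ (k + 1) p.1) (φ (k + 1) p.2) ⊆ A) ∧
      (φ (k + 1) p.1 ∉ A → segment ℝ (φ (k + 1) p.1) (φ (k + 1) p.2) ⊆ B) := by
    intro k p hp
    have h1 := isPreconnected_iff_subset_of_disjoint_closed.1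
      (convex_segment (𝕜 := ℝ) (φ (k + 1) p.1) (φ (k + 1) p.2)).isPreconnected A B hA hB
      ((hseg k p hp).trans hAB) (by
        rw [← Set.subset_empty_iff, ← hdisj]
        exact Set.inter_subset_inter_left _ (hseg k p hp))
    have hl := left_mem_segment ℝ (φ (k + 1) p.1) (φ (k + 1) p.2)
    have hr := right_mem_segment ℝ (φ (k + 1) p.1) (φ (k + 1) p.2)
    rcases h1 with h1 | h1
    · exact ⟨iff_of_true (h1 hl) (h1 hr), fun _ => h1, fun h => absurd (h1 hl) h⟩
    · have n1 : φ (k + 1) p.1 ∉ A := fun h => hnot _ (hseg k p hp hl) h (h1 hl)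
      have n2 : φ (k + 1) p.2 ∉ A := fun h => hnot _ (hseg k p hp hr) h (h1 hr)
      exact ⟨iff_of_false n1 n2, fun h => absurd h n1, fun _ => h1⟩
  obtain ⟨N, hN⟩ := eventually_atTop.1 (ht.eventually_lt_const hη)
  -- Downward induction: once t k < η, close points cannot be separated. A close pair at scale k has
  -- the same limits as its children, which are within R k, and `D k` transfers the claim from scale
  -- k + 1.
  have hfine : ∀ k, ∀ x ∈ V k, ∀ y ∈ V k, dist x y ≤ s k → (φ k x ∈ A ↔ φ k y ∈ A) := by
    have hlarge : ∀ k, N ≤ k → ∀ x ∈ V k, ∀ y ∈ V k, dist x y ≤ s k →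
        (φ k x ∈ A ↔ φ k y ∈ A) := fun k hk x hx y hy hd =>
      hfar' _ (hWΓ (hφW k x hx)) _ (hWΓ (hφW k y hy)) ((hφs k x hx y hy hd).trans_lt (hN k hk))
    have hdown : ∀ n k, N ≤ k + n → ∀ x ∈ V k, ∀ y ∈ V k, dist x y ≤ s k →
        (φ k x ∈ A ↔ φ k y ∈ A) := by
      intro n
      induction n with
      | zero => exact fun k hk => hlarge k hk
      | succ n ih =>
        intro k hk x hx y hy hd
        obtain ⟨x', hx', y', hy', e1, e2, hd'⟩ := hchild k x hx y hy hd
        rw [← e1, ← e2]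
        exact hD k (fun z => φ (k + 1) z ∈ A) (ih (k + 1) (by omega)) (fun p hp => (hsegA k p hp).1)
          x' hx' y' hy' hd'
    exact fun k => hdown N k (by omega)
  have hcoarse : ∀ k, ∀ x ∈ V (k + 1), ∀ y ∈ V (k + 1), dist x y ≤ R k →
      (φ (k + 1) x ∈ A ↔ φ (k + 1) y ∈ A) := fun k =>
    hD k (fun z => φ (k + 1) z ∈ A) (hfine (k + 1)) (fun p hp => (hsegA k p hp).1)
  -- Now the induction goes up in k: each point is tied to a child of its parent, starting from `V
  -- 1`, whose points are all within R 0.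
  have hall : ∀ k, ∀ x ∈ V (k + 1), ∀ y ∈ V (k + 1),
      (φ (k + 1) x ∈ A ↔ φ (k + 1) y ∈ A) := by
    intro k
    induction k with
    | zero => exact fun x hx y hy => hcoarse 0 x hx y hy (hbase x hx y hy)
    | succ k ih =>
      intro x hx y hy
      obtain ⟨u, hu, u', hu', e1, h1⟩ := hparent (k + 1) x hx
      obtain ⟨v, hv, v', hv', e2, h2⟩ := hparent (k + 1) y hy
      rw [hcoarse (k + 1) x hx u' hu' h1, hcoarse (k + 1) y hy v' hv' h2, e1, e2]
      exact ih u hu v hv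
  have hW : ∀ p ∈ W, ∀ q ∈ W, (p ∈ A ↔ q ∈ A) := by
    intro p hp q hq
    obtain ⟨x, hx, h1⟩ := hWφ (N + 1) p hp
    obtain ⟨y, hy, h2⟩ := hWφ (N + 1) q hq
    have h3 := hN (N + 1) (by omega)
    rw [hfar' p (hWΓ hp) _ (hWΓ (hφW _ x hx)) (h1.trans_lt h3),
      hfar' q (hWΓ hq) _ (hWΓ (hφW _ y hy)) (h2.trans_lt h3)]
    exact hall N x hx y hy
  by_cases hWA : ∃ p ∈ W, p ∈ A
  · obtain ⟨p, hp, hpA⟩ := hWA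
    left
    rintro x (hx | hx)
    · exact (hW p hp x hx).1 hpA
    · simp only [Set.mem_iUnion] at hx
      obtain ⟨k, q, hq, hx⟩ := hx
      exact (hsegA k q hq).2.1 ((hW p hp _ (hφW _ _ (hDV k q hq).1)).1 hpA) hx
  · right
    rintro x (hx | hx)
    · exact hmem x (hWΓ hx) fun h => hWA ⟨x, hx, h⟩
    · simp only [Set.mem_iUnion] at hx
      obtain ⟨k, q, hq, hx⟩ := hx
      exact (hsegA k q hq).2.2 (fun h => hWA ⟨_, hφW _ _ (hDV k q hq).1, h⟩) hx

end Bridges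

/-! ### Summing the potential inequality. -/

section Counting

variable {H : Type*} [NormedAddCommGroup H] [InnerProductSpace ℝ H]

namespace ScaleStep

variable {C ρ ρ' : ℝ} {P Q : Finset H} {a : H → ℝ} {e : H → H}

lemma card_not_flat_le (h : ScaleStep C ρ ρ' P Q a e) :
    ((Q.filter fun w => 1 / 100 < a w).card : ℝ) * ρ' ≤ 10000 * ∑ w ∈ Q, a w ^ 2 * ρ' := by
  have hρ := h.pos
  have h1 : ∀ w ∈ Q.filter fun w => 1 / 100 < a w, ρ' ≤ 10000 * (a w ^ 2 * ρ') := by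
    intro w hw
    have h2 := (Finset.mem_filter.1 hw).2
    have h3 : (1 : ℝ) ≤ 10000 * a w ^ 2 := by nlinarith
    nlinarith
  have h2 := Finset.card_nsmul_le_sum _ _ _ h1
  rw [nsmul_eq_mul] at h2
  refine h2.trans ?_
  rw [Finset.mul_sum]
  exact Finset.sum_le_sum_of_subset_of_nonneg (Finset.filter_subset _ _)
    fun w _ _ => by positivity

/-- One flat point puts all of `Q` near one line, where separated points are counted by projection;
if there is none, every point pays with its own error. No dimension enters. -/
lemma card_mul_le (h : ScaleStep C ρ ρ' P Q a e)
    (hQ : ∀ u ∈ Q, ∀ v ∈ Q, dist u v ≤ 2 * (C * ρ)) :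
    (Q.card : ℝ) * ρ' ≤ 7 * (C * ρ) + 10000 * ∑ w ∈ Q, a w ^ 2 * ρ' := by
  have hρ := h.pos
  have hC := h.mul_pos
  by_cases hw : ∃ w ∈ Q, a w ≤ 1 / 100
  · obtain ⟨w, hw, haw⟩ := hw
    have hfl := h.flatNear hw (v := w) (by rw [dist_self]; linarith) haw
    have h1 : (Q.card : ℝ) ≤ 3 * (2 * (C * ρ) / ρ') + 1 := by
      refine card_le_of_flat (c := w) (h.unit w hw) hρ (by positivity) h.sepQ
        (fun u hu v hv => hfl u (Or.inr hu) v (Or.inr hv) ?_ ?_) fun u hu => ?_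
      · linarith [hQ u hu w hw]
      · linarith [hQ v hv w hw]
      · rw [div_mul_cancel₀ _ hρ.ne']
        exact hQ u hu w hw
    have h2 : (Q.card : ℝ) * ρ' ≤ (3 * (2 * (C * ρ) / ρ') + 1) * ρ' := by gcongr
    have h3 : (3 * (2 * (C * ρ) / ρ') + 1) * ρ' = 6 * (C * ρ) + ρ' := by field_simp; ring
    have h4 : 0 ≤ ∑ w ∈ Q, a w ^ 2 * ρ' := Finset.sum_nonneg fun w _ => by positivity
    linarith [h.le_mul, h.two_mul_le]
  · push Not at hw
    have := h.card_not_flat_le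
    rw [Finset.filter_true_of_mem hw] at this
    linarith

/-- Few flat points can be close to a given finite set. -/
lemma card_le_of_close (h : ScaleStep C ρ ρ' P Q a e) {B Z : Finset H} (hBQ : B ⊆ Q)
    (hB : ∀ v ∈ B, a v ≤ 1 / 100 ∧ ∃ w ∈ Z, dist w v ≤ C * ρ') :
    (B.card : ℝ) ≤ 7 * C * Z.card := by
  classical
  have hρ := h.pos
  have hC := h.mul_pos
  have hCC := h.two_mul_mul_le
  have h1 := h.one_lt
  have hB2 : ∀ v ∈ B, ∃ w ∈ Z, dist w v ≤ C * ρ' := fun v hv => (hB v hv).2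
  choose! f hfZ hfd using hB2
  -- Each fibre of f is flat and has radius 2Cρ', so it has at most 6C + 1 ≤ 7C points.
  have hcard := Finset.card_le_mul_card_image_of_maps_to hfZ ⌊7 * C⌋₊ (by
    intro w _
    rcases (B.filter fun v => f v = w).eq_empty_or_nonempty with hem | ⟨v₀, hv₀⟩
    · rw [hem]; simp
    obtain ⟨hv₀B, hv₀w⟩ := Finset.mem_filter.1 hv₀
    have hd : ∀ u ∈ B.filter fun v => f v = w, dist u v₀ ≤ 2 * C * ρ' := by
      intro u hu
      obtain ⟨huB, huw⟩ := Finset.mem_filter.1 hu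
      have h2 := hfd u huB
      have h3 := hfd v₀ hv₀B
      rw [huw] at h2; rw [hv₀w] at h3
      linarith [dist_triangle_left u v₀ w]
    have hfl := h.flatNear (hBQ hv₀B) (v := v₀) (by rw [dist_self]; linarith) (hB v₀ hv₀B).1
    refine Nat.le_floor ?_
    refine (card_le_of_flat (c := v₀) (M := 2 * C) (h.unit v₀ (hBQ hv₀B)) hρ (by linarith)
      (fun u hu v hv => h.sepQ u (hBQ (Finset.mem_filter.1 hu).1) v
        (hBQ (Finset.mem_filter.1 hv).1)) (fun u hu v hv => ?_) hd).trans (by linarith)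
    exact hfl u (Or.inr (hBQ (Finset.mem_filter.1 hu).1)) v
      (Or.inr (hBQ (Finset.mem_filter.1 hv).1)) (by linarith [hd u hu]) (by linarith [hd v hv]))
  have h2 : (B.card : ℝ) ≤ (⌊7 * C⌋₊ : ℝ) * Z.card := by exact_mod_cast hcard
  have h3 : (⌊7 * C⌋₊ : ℝ) ≤ 7 * C := Nat.floor_le (by linarith)
  refine h2.trans ?_
  gcongr

end ScaleStep

variable {C δ r S : ℝ} {V : ℕ → Finset H} {α : ℕ → H → ℝ} {e : ℕ → H → H}

open Classical in
/-- The points of the `(k + 1)`-st net around which the next gap may open up. -/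
noncomputable def breakPoints (C δ r : ℝ) (V : ℕ → Finset H) (α : ℕ → H → ℝ) (k : ℕ) : Finset H :=
  (V (k + 1)).filter fun v =>
    1 / 100 < α (k + 1) v ∨ IsEndpoint (V (k + 1)) (10 * C * (δ ^ (k + 1) * r)) v

lemma mem_breakPoints {k : ℕ} {v : H} : v ∈ breakPoints C δ r V α k ↔ v ∈ V (k + 1) ∧
    (1 / 100 < α (k + 1) v ∨ IsEndpoint (V (k + 1)) (10 * C * (δ ^ (k + 1) * r)) v) := by
  classical
  exact Finset.mem_filter

/-- Uniform bounds for the size of the nets and for the total number of break points. -/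
theorem card_bounds (hC : 1 < C) (hδ₀ : 0 < δ) (hδ₁ : δ ≤ 1 / 2) (hr : 0 < r)
    (hS : ∀ k, ScaleStep C (δ ^ k * r) (δ ^ (k + 1) * r) (V k) (V (k + 1)) (α (k + 1)) (e (k + 1)))
    (hdiam : ∀ u ∈ V 1, ∀ v ∈ V 1, dist u v ≤ 2 * (C * r))
    (hchild : ∀ k, ∀ v ∈ V k, ∃ v' ∈ V (k + 1), dist v' v ≤ C * (δ ^ k * r))
    (hsum : ∀ n, ∑ k ∈ Finset.range n, ∑ v ∈ V (k + 1), α (k + 1) v ^ 2 * (δ ^ (k + 1) * r) ≤ S)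
    (n : ℕ) :
    ((V (n + 1)).card : ℝ) * (δ ^ (n + 1) * r) ≤ 400000 * C ^ 2 / δ * (r + S) ∧
    ∑ k ∈ Finset.range n, ((breakPoints C δ r V α k).card : ℝ) * (δ ^ (k + 1) * r) ≤
      400000 * C ^ 2 / δ * (r + S) := by
  classical
  set A : ℕ → ℝ := fun k => ∑ v ∈ V (k + 1), α (k + 1) v ^ 2 * (δ ^ (k + 1) * r) with hA
  have hA0 : ∀ k, 0 ≤ A k := fun k => Finset.sum_nonneg fun v _ => by positivity
  have hS0 : 0 ≤ S := by simpa using hsum 0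
  have hshift : ∑ k ∈ Finset.range n, A (k + 1) ≤ S := by
    have := hsum (n + 1)
    rw [Finset.sum_range_succ'] at this
    linarith [hA0 0]
  set Ψ : ℕ → ℝ := fun k => ∑ v ∈ V k, locLen (V k) (10 * C * (δ ^ k * r)) v with hΨ
  set G : ℕ → Finset H := fun k => (V (k + 1)).filter fun v =>
    (∃ w ∈ V (k + 2), dist w v ≤ C * (δ ^ (k + 1) * r) ∧ α (k + 2) w ≤ 1 / 100) ∧
      IsEndpoint (V (k + 1)) (10 * C * (δ ^ (k + 1) * r)) v with hG
  have hρ : ∀ k, 0 < δ ^ k * r := fun k => by positivity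
  have hstep : ∀ k, Ψ (k + 2) + (δ ^ (k + 1) * r) * (G k).card ≤
      Ψ (k + 1) + 200000 * C ^ 2 / δ * A (k + 1) := by
    intro k
    have h1 := (hS (k + 1)).sum_locLen_le (Finset.filter_subset _ _ : G k ⊆ V (k + 1))
      fun v hv => (Finset.mem_filter.1 hv).2
    -- The one-step inequality weights errors by the coarser scale; passing to their own scale costs
    -- 1/δ.
    have h2 : ∑ w ∈ V (k + 1 + 1), α (k + 1 + 1) w ^ 2 * (δ ^ (k + 1) * r) = A (k + 1) / δ := by
      rw [hA, Finset.sum_div]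
      refine Finset.sum_congr rfl fun w _ => ?_
      field_simp
      ring
    rw [h2] at h1
    calc _ ≤ _ := h1
      _ = _ := by simp only [hΨ]; ring
  -- The telescoping starts at generation 1, because no line is attached to `V 0`.
  have hbase : Ψ 1 ≤ 70 * C ^ 2 * r + 100000 * C * S := by
    have h1 := (hS 0).card_mul_le (by simpa using hdiam)
    have h2 : Ψ 1 ≤ (V 1).card * (10 * C * (δ ^ 1 * r)) := by
      rw [← nsmul_eq_mul]
      exact Finset.sum_le_card_nsmul _ _ _ fun v hv =>
        locLen_le_scale (by have := hρ 1; positivity) hv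
    have h3 := hsum 1
    simp only [Finset.sum_range_one, zero_add, pow_zero, one_mul] at h1 h3
    have h4 : 10 * C * ((V 1).card * (δ ^ 1 * r)) ≤ 10 * C * (7 * (C * r) + 10000 * S) := by
      gcongr
      linarith
    calc Ψ 1 ≤ _ := h2
      _ = 10 * C * ((V 1).card * (δ ^ 1 * r)) := by ring
      _ ≤ _ := h4
      _ = _ := by ring
  have htel : ∀ m, Ψ (m + 1) + ∑ k ∈ Finset.range m, (δ ^ (k + 1) * r) * (G k).card ≤
      Ψ 1 + 200000 * C ^ 2 / δ * ∑ k ∈ Finset.range m, A (k + 1) := by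
    intro m
    induction m with
    | zero => simp
    | succ m ih =>
      rw [Finset.sum_range_succ, Finset.sum_range_succ, mul_add]
      linarith [hstep m]
  have hCδ : C ^ 2 ≤ C ^ 2 / δ := by
    rw [le_div_iff₀ hδ₀]
    nlinarith [sq_nonneg C]
  have hCC : C ≤ C ^ 2 := by nlinarith
  have hmain : Ψ (n + 1) + ∑ k ∈ Finset.range n, (δ ^ (k + 1) * r) * (G k).card ≤
      70 * (C ^ 2 / δ) * r + 300000 * (C ^ 2 / δ) * S := by
    have h1 : 200000 * C ^ 2 / δ * ∑ k ∈ Finset.range n, A (k + 1) ≤ 200000 * C ^ 2 / δ * S := by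
      gcongr
    have h2 : 70 * C ^ 2 * r ≤ 70 * (C ^ 2 / δ) * r := by gcongr
    have h3 : 100000 * C * S ≤ 100000 * (C ^ 2 / δ) * S := by
      gcongr; linarith
    have h4 : 200000 * C ^ 2 / δ * S = 200000 * (C ^ 2 / δ) * S := by ring
    linarith [htel n]
  have hfin : 70 * (C ^ 2 / δ) * r + 400000 * (C ^ 2 / δ) * S ≤
      400000 * C ^ 2 / δ * (r + S) := by
    have : 0 ≤ C ^ 2 / δ * r := by positivity
    have h4 : 400000 * C ^ 2 / δ * (r + S) =
      400000 * (C ^ 2 / δ * r) + 400000 * (C ^ 2 / δ) * S := by ring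
    linarith
  have hCS : 0 ≤ C ^ 2 / δ * S := by positivity
  constructor
  · have h1 : ∀ v ∈ V (n + 1), δ ^ (n + 1) * r ≤
        locLen (V (n + 1)) (10 * C * (δ ^ (n + 1) * r)) v := fun v hv =>
      le_locLen_of_separated hv (by nlinarith [hρ (n + 1)]) fun u hu huv =>
        (hS n).sepQ u hu v hv huv
    have h2 := Finset.card_nsmul_le_sum _ _ _ h1
    rw [nsmul_eq_mul] at h2
    have h3 : 0 ≤ ∑ k ∈ Finset.range n, (δ ^ (k + 1) * r) * ((G k).card : ℝ) :=
      Finset.sum_nonneg fun k _ => by have := hρ (k + 1); positivity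
    linarith
  · have hX : ∀ k, ((breakPoints C δ r V α k).card : ℝ) * (δ ^ (k + 1) * r) ≤
        10000 * A k + 70000 * (C / δ) * A (k + 1) + (δ ^ (k + 1) * r) * (G k).card := by
      intro k
      set B₁ := (V (k + 1)).filter fun v => 1 / 100 < α (k + 1) v with hB₁
      set Z := (V (k + 2)).filter fun w => 1 / 100 < α (k + 2) w with hZ
      set B₂ := (V (k + 1)).filter fun v => α (k + 1) v ≤ 1 / 100 ∧
        ∃ w ∈ Z, dist w v ≤ C * (δ ^ (k + 1) * r) with hB₂
      -- A break point is non-flat, or flat with a non-flat child, or an endpoint with a flat child.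
      -- The first two kinds are paid for by errors, the last by the drop of Ψ.
      have hsub : breakPoints C δ r V α k ⊆ B₁ ∪ B₂ ∪ G k := by
        intro v hv
        obtain ⟨hvV, hv'⟩ := mem_breakPoints.1 hv
        by_cases h1 : 1 / 100 < α (k + 1) v
        · exact Finset.mem_union_left _ (Finset.mem_union_left _ (Finset.mem_filter.2 ⟨hvV, h1⟩))
        obtain ⟨w, hw, hd⟩ := hchild (k + 1) v hvV
        by_cases h2 : 1 / 100 < α (k + 2) w
        · exact Finset.mem_union_left _ (Finset.mem_union_right _ (Finset.mem_filter.2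
            ⟨hvV, not_lt.1 h1, w, Finset.mem_filter.2 ⟨hw, h2⟩, hd⟩))
        · exact Finset.mem_union_right _ (Finset.mem_filter.2
            ⟨hvV, ⟨w, hw, hd, not_lt.1 h2⟩, hv'.resolve_left h1⟩)
      have hcard : ((breakPoints C δ r V α k).card : ℝ) ≤ B₁.card + B₂.card + (G k).card := by
        have h1 := (Finset.card_le_card hsub).trans ((Finset.card_union_le _ _).trans
          (Nat.add_le_add_right (Finset.card_union_le _ _) _))
        exact_mod_cast h1
      have h1 : (B₁.card : ℝ) * (δ ^ (k + 1) * r) ≤ 10000 * A k := (hS k).card_not_flat_le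
      have h2 : (B₂.card : ℝ) ≤ 7 * C * Z.card :=
        (hS k).card_le_of_close (Finset.filter_subset _ _) fun v hv => (Finset.mem_filter.1 hv).2
      have h3 : (Z.card : ℝ) * (δ ^ (k + 2) * r) ≤ 10000 * A (k + 1) :=
        (hS (k + 1)).card_not_flat_le
      have h4 : (B₂.card : ℝ) * (δ ^ (k + 1) * r) ≤ 70000 * (C / δ) * A (k + 1) := by
        calc (B₂.card : ℝ) * (δ ^ (k + 1) * r) ≤ 7 * C * Z.card * (δ ^ (k + 1) * r) := by
              have := hρ (k + 1); gcongr
          _ = 7 * (C / δ) * (Z.card * (δ ^ (k + 2) * r)) := by field_simp; ring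
          _ ≤ 7 * (C / δ) * (10000 * A (k + 1)) := by gcongr
          _ = _ := by ring
      have h5 := mul_le_mul_of_nonneg_right hcard (hρ (k + 1)).le
      linarith
    have h1 := Finset.sum_le_sum fun k (_ : k ∈ Finset.range n) => hX k
    rw [Finset.sum_add_distrib, Finset.sum_add_distrib, ← Finset.mul_sum, ← Finset.mul_sum] at h1
    have h2 : ∑ k ∈ Finset.range n, A k ≤ S := hsum n
    have h3 : 70000 * (C / δ) * ∑ k ∈ Finset.range n, A (k + 1) ≤ 70000 * (C ^ 2 / δ) * S := by
      gcongr
    have h4 : 0 ≤ Ψ (n + 1) := Finset.sum_nonneg fun v hv => (hρ (n + 1)).le.trans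
      (le_locLen_of_separated hv (by nlinarith [hρ (n + 1)]) fun u hu huv =>
        (hS n).sepQ u hu v hv huv)
    have h5 : S ≤ C ^ 2 / δ * S := by
      have : 1 ≤ C ^ 2 / δ := by linarith
      nlinarith
    linarith

end Counting

/-! ### Measure of the limit set and of the bridges. -/

section Measure

/-- A set that is covered, at arbitrarily small scales `ρ k`, by at most `M / ρ k` balls of radius
`c * ρ k` has finite one-dimensional measure. -/
lemma hausdorffMeasure_one_le_of_cover {X : Type*} [MetricSpace X] [MeasurableSpace X]
    [BorelSpace X] {W : Set X} {V : ℕ → Finset X} {ρ : ℕ → ℝ} {c M : ℝ} (hc : 0 ≤ c)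
    (hρ : Tendsto ρ atTop (𝓝 0))
    (hcover : ∀ k, ∀ p ∈ W, ∃ v ∈ V k, dist p v ≤ c * ρ k)
    (hcard : ∀ k, ((V k).card : ℝ) * ρ k ≤ M) : μH[1] W ≤ ENNReal.ofReal (2 * c * M) := by
  have hdiam : ∀ k (x : X), Metric.ediam (Metric.closedBall x (c * ρ k)) ≤
      ENNReal.ofReal (2 * (c * ρ k)) := by
    intro k x
    refine Metric.ediam_le fun y hy z hz => ?_
    rw [edist_dist]
    apply ENNReal.ofReal_le_ofReal
    rw [Metric.mem_closedBall] at hy hz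
    linarith [dist_triangle_right y z x]
  refine (Measure.hausdorffMeasure_le_liminf_sum (ι := fun k => V k) (l := atTop) 1 W
    (fun k => ENNReal.ofReal (2 * (c * ρ k))) ?_
    (fun k v => Metric.closedBall (v : X) (c * ρ k))
    (Eventually.of_forall fun k v => hdiam k v) (Eventually.of_forall fun k p hp => ?_)).trans ?_
  · have := ENNReal.tendsto_ofReal ((hρ.const_mul c).const_mul 2)
    simpa using this
  · obtain ⟨v, hv, hd⟩ := hcover k p hp
    exact Set.mem_iUnion.2 ⟨⟨v, hv⟩, hd⟩
  · refine liminf_le_of_le (by isBoundedDefault) fun b hb => ?_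
    obtain ⟨k, hk⟩ := hb.exists
    refine hk.trans ?_
    calc _ ≤ ∑ _v : V k, ENNReal.ofReal (2 * (c * ρ k)) := by
          refine Finset.sum_le_sum fun v _ => ?_
          rw [ENNReal.rpow_one]
          exact hdiam k v
      _ = ENNReal.ofReal (2 * c * ((V k).card * ρ k)) := by
          rw [Finset.sum_const, Finset.card_univ, Fintype.card_coe, nsmul_eq_mul,
            ← ENNReal.ofReal_natCast, ← ENNReal.ofReal_mul (Nat.cast_nonneg _)]
          congr 1; ring
      _ ≤ _ := ENNReal.ofReal_le_ofReal (mul_le_mul_of_nonneg_left (hcard k) (by positivity))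

lemma hausdorffMeasure_iUnion_segment_le {H : Type*} [NormedAddCommGroup H] [NormedSpace ℝ H]
    [MeasurableSpace H] [BorelSpace H] {D : ℕ → Finset (H × H)} {φ : ℕ → H → H} {t : ℕ → ℝ} {M : ℝ}
    (ht : ∀ k, 0 ≤ t k) (hD : ∀ k, ∀ p ∈ D k, dist (φ k p.1) (φ k p.2) ≤ t k)
    (hM : ∀ n, ∑ k ∈ Finset.range n, ((D k).card : ℝ) * t k ≤ M) :
    μH[1] (⋃ k, ⋃ p ∈ D k, segment ℝ (φ k p.1) (φ k p.2)) ≤ ENNReal.ofReal M := by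
  refine (measure_iUnion_le _).trans (ENNReal.tsum_le_of_sum_range_le fun n => ?_)
  calc _ ≤ ∑ k ∈ Finset.range n, ENNReal.ofReal ((D k).card * t k) := by
        refine Finset.sum_le_sum fun k _ => (measure_biUnion_finset_le _ _).trans ?_
        calc _ ≤ ∑ _p ∈ D k, ENNReal.ofReal (t k) := by
              refine Finset.sum_le_sum fun p hp => ?_
              rw [hausdorffMeasure_segment, edist_dist]
              exact ENNReal.ofReal_le_ofReal (hD k p hp)
          _ = _ := by
              rw [Finset.sum_const, nsmul_eq_mul, ← ENNReal.ofReal_natCast,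
                ← ENNReal.ofReal_mul (Nat.cast_nonneg _)]
    _ = ENNReal.ofReal (∑ k ∈ Finset.range n, (D k).card * t k) :=
        (ENNReal.ofReal_sum_of_nonneg fun k _ => mul_nonneg (Nat.cast_nonneg _) (ht k)).symm
    _ ≤ _ := ENNReal.ofReal_le_ofReal (hM n)

end Measure

/-! ### Assembly of the theorem. -/

theorem theoremC (C δ : ℝ) (hC : 1 < C) (hδ₀ : 0 < δ) (hδ₁ : δ ≤ 1 / 2) :
    ∃ K : ℝ, 0 < K ∧
      ∀ (H : Type u) [NormedAddCommGroup H] [InnerProductSpace ℝ H] [CompleteSpace H]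
        [MeasurableSpace H] [BorelSpace H]
        (x₀ : H) (r₀ : ℝ) (_ : 0 < r₀)
        (V : ℕ → Finset H)
        (_ : ∀ k, (V k).Nonempty)
        (_ : ∀ k, (V k : Set H) ⊆ Metric.closedBall x₀ (C * r₀))
        (_ : ∀ k, ∀ v ∈ V k, ∀ v' ∈ V k, v ≠ v' → δ ^ k * r₀ ≤ dist v v')
        (_ : ∀ k, ∀ v ∈ V k, ∃ v' ∈ V (k + 1), dist v' v < C * δ ^ k * r₀)
        (_ : ∀ k, 1 ≤ k → ∀ v ∈ V k, ∃ v' ∈ V (k - 1), dist v' v < C * δ ^ k * r₀)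
        (l : ℕ → H → Set H) (α : ℕ → H → ℝ)
        (_ : ∀ k, 1 ≤ k → ∀ v ∈ V k, IsStraightLine (l k v))
        (_ : ∀ k, 1 ≤ k → ∀ v ∈ V k, 0 ≤ α k v)
        (_ : ∀ k, 1 ≤ k → ∀ v ∈ V k,
          ∀ x ∈ ((V (k - 1) : Set H) ∪ (V k : Set H)) ∩
              Metric.closedBall v (66 * C * δ ^ ((k : ℤ) - 2) * r₀),
            Metric.infDist x (l k v) ≤ α k v * δ ^ k * r₀)
        (_ : Summable fun k : ℕ =>
          ∑ v ∈ V (k + 1), α (k + 1) v ^ 2 * δ ^ (k + 1) * r₀),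
        ∃ W : Set H, IsCompact W ∧ W.Nonempty ∧ W ⊆ Metric.closedBall x₀ (C * r₀) ∧
          Tendsto (fun k => Metric.hausdorffEDist (V k : Set H) W) atTop (𝓝 0) ∧
          ∃ Γ : Set H, IsCompact Γ ∧ IsConnected Γ ∧
            Γ ⊆ Metric.closedBall x₀ (C * r₀) ∧ W ⊆ Γ ∧
            μH[1] Γ ≤ ENNReal.ofReal (K * (r₀ +
              ∑' k : ℕ, ∑ v ∈ V (k + 1), α (k + 1) v ^ 2 * δ ^ (k + 1) * r₀)) := by
  have hC0 : 0 < C := by linarith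
  -- The term 6C comes from covering W by balls of radius 3Cρ_k, the term 14C/δ from bridges of
  -- length 14Cρ_k counted at scale ρ_{k+1}; the other factor is the bound of `card_bounds`.
  refine ⟨(6 * C + 14 * C / δ) * (400000 * C ^ 2 / δ), by positivity, ?_⟩
  intro H _ _ _ _ _ x₀ r hr V hne hball hsep hchild hparent l α hl hα hlα hsumm
  have hρ : ∀ k, 0 < δ ^ k * r := fun k => by positivity
  have hCρ : ∀ k, 0 < C * (δ ^ k * r) := fun k => mul_pos hC0 (hρ k)
  have hδk : ∀ k, 2 * (δ ^ (k + 1) * r) ≤ δ ^ k * r := fun k => by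
    rw [pow_succ]; nlinarith [hρ k]
  have hchild' : ∀ k, ∀ v ∈ V k, ∃ v' ∈ V (k + 1), dist v' v ≤ C * (δ ^ k * r) := by
    intro k v hv
    obtain ⟨v', h1, h2⟩ := hchild k v hv
    exact ⟨v', h1, by linarith⟩
  have hparent' : ∀ k, ∀ v ∈ V (k + 1), ∃ v' ∈ V k, dist v' v ≤ C * (δ ^ (k + 1) * r) := by
    intro k v hv
    obtain ⟨v', h1, h2⟩ := hparent (k + 1) (by omega) v hv
    exact ⟨v', h1, by linarith⟩
  have hunit : ∀ k v, ∃ e : H, v ∈ V (k + 1) → ‖e‖ = 1 ∧ ∀ x y : H,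
      ‖perp e (x - y)‖ ≤ Metric.infDist x (l (k + 1) v) + Metric.infDist y (l (k + 1) v) := by
    intro k v
    by_cases hv : v ∈ V (k + 1)
    · obtain ⟨e, he⟩ := (hl (k + 1) (by omega) v hv).exists_unit
      exact ⟨e, fun _ => he⟩
    · exact ⟨0, fun h => absurd h hv⟩
  choose e he using hunit
  -- The exponent is an integer since it is -1 for the first generation. The spare factor 1/δ ≥ 2
  -- turns 66 into 132.
  have hwin : ∀ k : ℕ, 132 * C * (δ ^ k * r) ≤ 66 * C * δ ^ (((k + 1 : ℕ) : ℤ) - 2) * r := by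
    intro k
    have h1 : δ ^ (((k + 1 : ℕ) : ℤ) - 2) = δ ^ k / δ := by
      rw [show ((k + 1 : ℕ) : ℤ) - 2 = (k : ℤ) - 1 by push_cast; ring, zpow_sub_one₀ hδ₀.ne',
        zpow_natCast, div_eq_mul_inv]
    have h2 : 2 * δ ^ k ≤ δ ^ k / δ := by
      rw [le_div_iff₀ hδ₀]
      nlinarith [pow_pos hδ₀ k]
    rw [h1]
    calc 132 * C * (δ ^ k * r) = 66 * C * (2 * δ ^ k) * r := by ring
      _ ≤ _ := by gcongr
  have hS : ∀ k, ScaleStep C (δ ^ k * r) (δ ^ (k + 1) * r) (V k) (V (k + 1)) (α (k + 1)) (e k) := by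
    intro k
    refine ⟨hC, hρ _, hδk k, hsep k, hsep (k + 1), fun w hw => ?_, fun w hw => (he k w hw).1,
      fun w hw => hα (k + 1) (by omega) w hw, fun w hw x hx y hy hxw hyw => ?_⟩
    · obtain ⟨v, hv, h⟩ := hparent' k w hw
      exact ⟨v, hv, by rwa [dist_comm]⟩
    · have key : ∀ z, z ∈ V k ∨ z ∈ V (k + 1) → dist z w ≤ 132 * C * (δ ^ k * r) →
          Metric.infDist z (l (k + 1) w) ≤ α (k + 1) w * δ ^ (k + 1) * r := fun z hz hzw =>
        hlα (k + 1) (by omega) w hw z ⟨hz, hzw.trans (hwin k)⟩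
      linarith [(he k w hw).2 x y, key x hx hxw, key y hy hyw]
  set S : ℝ := ∑' k : ℕ, ∑ v ∈ V (k + 1), α (k + 1) v ^ 2 * δ ^ (k + 1) * r with hSdef
  have hsum : ∀ n, ∑ k ∈ Finset.range n, ∑ v ∈ V (k + 1),
      α (k + 1) v ^ 2 * (δ ^ (k + 1) * r) ≤ S := by
    intro n
    simp_rw [← mul_assoc]
    exact hsumm.sum_le_tsum _ fun k _ => Finset.sum_nonneg fun v _ => by positivity
  have hdiam : ∀ u ∈ V 1, ∀ v ∈ V 1, dist u v ≤ 2 * (C * r) := by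
    intro u hu v hv
    have h1 := Metric.mem_closedBall.1 (hball 1 hu)
    have h2 := Metric.mem_closedBall.1 (hball 1 hv)
    linarith [dist_triangle_right u v x₀]
  -- The family `e k` belongs to generation k + 1, hence the shift; at k = 0 the truncated
  -- subtraction gives a value that is never used.
  have hcard := card_bounds (V := V) (α := α) (e := fun k => e (k - 1)) hC hδ₀ hδ₁ hr
    (fun k => hS k) hdiam hchild' hsum
  obtain ⟨W, hWc, hWne, hWlim, hWV, φ, hφ, hφc⟩ := exists_hausdorff_limit (M := C * r) hδ₀ hδ₁ V hne
    (fun k v hv => by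
      obtain ⟨v', h1, h2⟩ := hchild' k v hv
      exact ⟨v', h1, h2.trans_eq (by ring)⟩)
    (fun k v hv => by
      obtain ⟨v', h1, h2⟩ := hparent' k v hv
      refine ⟨v', h1, ?_⟩
      nlinarith [hδk k, hρ (k + 1)])
  have hr' : ∀ k, C * r * δ ^ k = C * (δ ^ k * r) := fun k => by ring
  simp only [hr'] at hWV hφ hφc
  have hlim : Tendsto (fun k => δ ^ k * r) atTop (𝓝 0) := by
    simpa using (tendsto_pow_atTop_nhds_zero_of_lt_one hδ₀.le (by linarith : δ < 1)).mul_const r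
  have hWball : W ⊆ Metric.closedBall x₀ (C * r) := by
    intro p hp
    have h1 : Tendsto (fun k => C * r + 3 * (C * (δ ^ k * r))) atTop (𝓝 (C * r)) := by
      simpa using ((hlim.const_mul C).const_mul 3).const_add (C * r)
    refine ge_of_tendsto' h1 fun k => ?_
    obtain ⟨v, hv, hd⟩ := hWV k p hp
    have h2 := Metric.mem_closedBall.1 (hball k hv)
    linarith [dist_triangle p v x₀]
  have hφφ : ∀ k, ∀ u ∈ V k, ∀ v ∈ V k,
      dist (φ k u) (φ k v) ≤ dist u v + 4 * (C * (δ ^ k * r)) := by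
    intro k u hu v hv
    have h1 := (hφ k u hu).2
    have h2 := (hφ k v hv).2
    have h3 := dist_triangle4 (φ k u) u v (φ k v)
    rw [dist_comm (φ k u) u] at h3
    linarith
  have hbr : ∀ k, ∃ D : Finset (H × H), D.card ≤ (breakPoints C δ r V α k).card ∧
      (∀ p ∈ D, p.1 ∈ V (k + 1) ∧ p.2 ∈ V (k + 1) ∧ dist p.1 p.2 ≤ 12 * C * (δ ^ k * r)) ∧
      ∀ f : H → Prop, (∀ x ∈ V (k + 1), ∀ y ∈ V (k + 1),
        dist x y ≤ 10 * C * (δ ^ (k + 1) * r) → (f x ↔ f y)) → (∀ p ∈ D, (f p.1 ↔ f p.2)) →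
        ∀ x ∈ V (k + 1), ∀ y ∈ V (k + 1), dist x y ≤ 12 * C * (δ ^ k * r) → (f x ↔ f y) := by
    intro k
    set E : Setoid H := Relation.EqvGen.setoid fun x y => x ∈ V (k + 1) ∧ y ∈ V (k + 1) ∧
      dist x y ≤ 10 * C * (δ ^ (k + 1) * r) with hE
    obtain ⟨D, hD1, hD2, hD3⟩ := exists_spanning_pairs (V (k + 1))
      (R := fun x y => dist x y ≤ 12 * C * (δ ^ k * r)) (fun x y h => by rwa [dist_comm])
      (breakPoints C δ r V α k) E (by
        intro x hx y hy hxy hnE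
        by_cases hflat : α (k + 1) x ≤ 1 / 100
        · obtain ⟨z, hz, hxz, hend⟩ := (hS k).exists_isEndpoint E
            (fun u hu v hv huv => Relation.EqvGen.rel _ _ ⟨hu, hv, huv⟩) hy hx hflat
            (by rwa [dist_comm]) hnE
          exact ⟨z, mem_breakPoints.2 ⟨hz, Or.inr hend⟩, E.symm hxz⟩
        · exact ⟨x, mem_breakPoints.2 ⟨hx, Or.inl (not_le.1 hflat)⟩, E.refl x⟩)
    refine ⟨D, hD1, hD2, fun f hf hfD => hD3 f (fun x y hxy => ?_) hfD⟩
    have hxy' : Relation.EqvGen _ x y := hxy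
    induction hxy' with
    | rel x y h => exact hf x h.1 y h.2.1 h.2.2
    | refl x => exact Iff.rfl
    | symm x y _ ih => exact (ih (by assumption)).symm
    | trans x y z _ _ ih1 ih2 => exact (ih1 (by assumption)).trans (ih2 (by assumption))
  choose D hDcard hDV hD using hbr
  have hDlen : ∀ k, ∀ p ∈ D k,
      dist (φ (k + 1) p.1) (φ (k + 1) p.2) ≤ 14 * (C * (δ ^ k * r)) := by
    intro k p hp
    obtain ⟨h1, h2, h3⟩ := hDV k p hp
    have := hφφ (k + 1) _ h1 _ h2
    nlinarith [hδk k]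
  set Γ : Set H := W ∪ ⋃ k, ⋃ p ∈ D k, segment ℝ (φ (k + 1) p.1) (φ (k + 1) p.2) with hΓ
  have ht : Tendsto (fun k => 14 * (C * (δ ^ k * r))) atTop (𝓝 0) := by
    simpa using (hlim.const_mul C).const_mul 14
  have hΓc : IsCompact Γ := by
    refine isCompact_union_iUnion hWc (fun k => ?_) fun ε hε => ?_
    · refine (D k).isCompact_biUnion fun p _ => ?_
      rw [segment_eq_image_lineMap]
      exact isCompact_Icc.image (AffineMap.lineMap_continuous)
    · filter_upwards [ht.eventually_lt_const hε] with k hk x hx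
      simp only [Set.mem_iUnion] at hx
      obtain ⟨p, hp, hx⟩ := hx
      refine Metric.mem_thickening_iff.2 ⟨φ (k + 1) p.1, (hφ _ _ (hDV k p hp).1).1, ?_⟩
      refine lt_of_le_of_lt ?_ hk
      refine le_trans ?_ (hDlen k p hp)
      rw [dist_comm]
      have := dist_add_dist_of_mem_segment hx
      linarith [dist_nonneg (x := x) (y := φ (k + 1) p.2)]
  refine ⟨W, hWc, hWne, hWball, hWlim, Γ, hΓc, ⟨hWne.mono Set.subset_union_left, ?_⟩, ?_,
    Set.subset_union_left, ?_⟩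
  -- Children of points at distance 10Cρ_k are within 12Cρ_k, which fixes R. The maps φ add at most
  -- 4Cρ_k to such a distance, which fixes t.
  · refine isPreconnected_union_segments (V := V) (s := fun k => 10 * C * (δ ^ k * r))
      (t := fun k => 14 * (C * (δ ^ k * r))) (R := fun k => 12 * C * (δ ^ k * r)) ht hΓc
      (fun k v hv => (hφ k v hv).1) ?_ ?_ ?_ ?_ ?_
      (fun k p hp => ⟨(hDV k p hp).1, (hDV k p hp).2.1⟩) hD
    · intro k u hu v hv hd
      linarith [hφφ k u hu v hv]
    · intro k p hp
      obtain ⟨v, hv, hd⟩ := hWV k p hp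
      refine ⟨v, hv, ?_⟩
      linarith [dist_triangle p v (φ k v), (hφ k v hv).2, hCρ k]
    · intro k u hu v hv hd
      obtain ⟨u', hu', h1, h2⟩ := hφc k u hu
      obtain ⟨v', hv', h3, h4⟩ := hφc k v hv
      refine ⟨u', hu', v', hv', h2, h4, ?_⟩
      have h5 := dist_triangle4 u' u v v'
      rw [dist_comm v v'] at h5
      linarith
    · intro k v hv
      obtain ⟨u, hu, h1⟩ := hparent' k v hv
      obtain ⟨u', hu', h2, h3⟩ := hφc k u hu
      refine ⟨u, hu, u', hu', h3, ?_⟩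
      have h4 := dist_triangle_right v u' u
      rw [dist_comm v u] at h4
      nlinarith [hδk k, hCρ k, hCρ (k + 1)]
    · intro u hu v hv
      have := hdiam u hu v hv
      simp only [pow_zero, one_mul]
      nlinarith
  · rintro x (hx | hx)
    · exact hWball hx
    · simp only [Set.mem_iUnion] at hx
      obtain ⟨k, p, hp, hx⟩ := hx
      exact (convex_closedBall x₀ (C * r)).segment_subset (hWball (hφ _ _ (hDV k p hp).1).1)
        (hWball (hφ _ _ (hDV k p hp).2.1).1) hx
  · set M₀ : ℝ := 400000 * C ^ 2 / δ * (r + S) with hM₀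
    have hS0 : 0 ≤ S := by simpa using hsum 0
    have hM₀0 : 0 ≤ M₀ := by positivity
    have h1 : μH[1] W ≤ ENNReal.ofReal (2 * (3 * C) * M₀) := by
      refine hausdorffMeasure_one_le_of_cover (V := fun k => V (k + 1))
        (ρ := fun k => δ ^ (k + 1) * r) (by positivity)
        (hlim.comp (tendsto_add_atTop_nat 1)) (fun k p hp => ?_) fun k => (hcard k).1
      obtain ⟨v, hv, hd⟩ := hWV (k + 1) p hp
      exact ⟨v, hv, by linarith⟩
    have h2 : μH[1] (⋃ k, ⋃ p ∈ D k, segment ℝ (φ (k + 1) p.1) (φ (k + 1) p.2)) ≤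
        ENNReal.ofReal (14 * C / δ * M₀) := by
      refine hausdorffMeasure_iUnion_segment_le (φ := fun k => φ (k + 1))
        (fun k => by linarith [hCρ k]) hDlen fun n => ?_
      refine le_trans ?_ (mul_le_mul_of_nonneg_left (hcard n).2
        (by positivity : 0 ≤ 14 * C / δ))
      rw [Finset.mul_sum]
      refine Finset.sum_le_sum fun k _ => ?_
      have h3 : ((D k).card : ℝ) ≤ (breakPoints C δ r V α k).card := by exact_mod_cast hDcard k
      calc ((D k).card : ℝ) * (14 * (C * (δ ^ k * r)))
          ≤ (breakPoints C δ r V α k).card * (14 * (C * (δ ^ k * r))) := by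
            have := hCρ k; gcongr
        _ = _ := by field_simp; ring
    refine (measure_union_le _ _).trans ((add_le_add h1 h2).trans ?_)
    rw [← ENNReal.ofReal_add (by positivity) (by positivity)]
    apply ENNReal.ofReal_le_ofReal
    rw [hM₀]
    apply le_of_eq; ring
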